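/- Let $(\mathcal C,\otimes,I,C)$ be a braided monoidal category (written as if strict), and let $H$ and $A$ be bialgebras in $\mathcal C$, with multiplications $m$, units $\eta$, comultiplications $\Delta$ and counits $\epsilon$. Let $\tau : H\otimes A\to I$ be a skew pairing, that is, $$\tau(m\otimes \mathrm{id})=\tau(\mathrm{id}\otimes\tau\otimes \mathrm{id})(\mathrm{id}\otimes \mathrm{id}\otimes\Delta),\qquad \tau(\mathrm{id}\otimes m)=(\tau\otimes\tau)(\mathrm{id}\otimes C_{H,A}\otimes \mathrm{id})(\Delta\otimes \mathrm{id}\otimes \mathrm{id}),$$ $$\tau(\mathrm{id}\otimes\eta)=\epsilon_H,\qquad \tau(\eta\otimes \mathrm{id})=\epsilon_A .$$ Assume that $\tau$ has a two-sided convolution inverse $\bar\tau : H\otimes A\to I$, where the convolution product of $\sigma,\sigma' : H\otimes A\to I$ is $(\sigma\otimes\sigma')(\mathrm{id}\otimes C_{H,A}\otimes \mathrm{id})(\Delta\otimes\Delta)$ and its unit is $\epsilon_H\otimes\epsilon_A$, and that $\tau$ is symmetric with respect to the braiding: $$(\mathrm{id}_U\otimes\tau)(C_{H,U}\otimes \mathrm{id}_A)=(\tau\otimes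 \mathrm{id}_U)(\mathrm{id}_H\otimes C_{U,A})\qquad\text{for } U=H \text{ and } U=A .$$ Define $\alpha : H\otimes A\to A$ and $\beta : H\otimes A\to H$ by $$\alpha=(\tau\otimes \mathrm{id}\otimes\bar\tau)(\mathrm{id}\otimes \mathrm{id}\otimes C_{H,A}\otimes \mathrm{id})(\mathrm{id}\otimes C_{H,A}\otimes\Delta)(\Delta\otimes\Delta),$$ $$\beta=(\tau\otimes \mathrm{id}\otimes\bar\tau)(\mathrm{id}\otimes C_{H,A}\otimes \mathrm{id}\otimes \mathrm{id})(\Delta\otimes C_{H,A}\otimes \mathrm{id})(\Delta\otimes\Delta).$$ Let the double cross product $A\bowtie_\tau H$ be the object $A\otimes H$ with the multiplication $$(m_A\otimes m_H)(\mathrm{id}\otimes\alpha\otimes\beta\otimes \mathrm{id})(\mathrm{id}\otimes \mathrm{id}\otimes C_{H,A}\otimes \mathrm{id}\otimes \mathrm{id})(\mathrm{id}\otimes\Delta_H\otimes\Delta_A\otimes \mathrm{id}),$$ the unit $\eta_A\otimes\eta_H$, the comultiplication $(\mathrm{id}\otimes C_{A,H}\otimes \mathrm{id})(\Delta_A\otimes\Delta_H)$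 and the counit $\epsilon_A\otimes\epsilon_H$. Then: 1. $A\bowtie_\tau H$ is an (associative, unital) algebra and a (coassociative, counital) coalgebra in $\mathcal C$. 2. If $A$ and $H$ are Hopf algebras (have antipodes), then $A\bowtie_\tau H$ has an antipode, i.e. a morphism $S : A\otimes H\to A\otimes H$ with $m(S\otimes \mathrm{id})\Delta=\eta\epsilon=m(\mathrm{id}\otimes S)\Delta$ for the above structure maps. 3. $A\bowtie_\tau H$ is a bialgebra in $\mathcal C$ if and only if $C_{A,H}C_{H,A}=\mathrm{id}_{H\otimes A}$. -/

import Mathlib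

open CategoryTheory MonoidalCategory
open scoped MonObj ComonObj

/-!
Bialgebras in a braided monoidal category `C` are Mathlib's `BimonObj`; the braiding is `β_`.
Composition `f ≫ g` is in diagrammatic order, and `f ⊗≫ g` is the composite of `f` and `g` with
the canonical associativity and unit isomorphisms of `C` inserted in between.
-/

universe v u

namespace DoubleCross

section

variable {C : Type u} [Category.{v} C] [MonoidalCategory C] [BraidedCategory C]

/-- The comultiplication `(id ⊗ C_{X,Y} ⊗ id) (Δ ⊗ Δ)` of the tensor product coalgebra
`X ⊗ Y`. -/
def tensorComul (X Y : C) [ComonObj X] [ComonObj Y] : X ⊗ Y ⟶ (X ⊗ Y) ⊗ (X ⊗ Y) :=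
  (Δ[X] ⊗ₘ Δ[Y]) ⊗≫ (𝟙 X ⊗ₘ (β_ X Y).hom ⊗ₘ 𝟙 Y) ⊗≫ 𝟙 ((X ⊗ Y) ⊗ (X ⊗ Y))

/-- The counit `ε ⊗ ε` of the tensor product coalgebra `X ⊗ Y`. -/
def tensorCounit (X Y : C) [ComonObj X] [ComonObj Y] : X ⊗ Y ⟶ 𝟙_ C :=
  (ε[X] ⊗ₘ ε[Y]) ⊗≫ 𝟙 (𝟙_ C)

/-- Skew pairings `τ : H ⊗ A ⟶ I`. In element notation: `τ(h h', a) = τ(h, a₂) τ(h', a₁)`,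
`τ(h, a a') = τ(h₁, a) τ(h₂, a')`, `τ(h, 1) = ε(h)` and `τ(1, a) = ε(a)`. -/
structure IsSkewPairing {H A : C} [BimonObj H] [BimonObj A] (τ : H ⊗ A ⟶ 𝟙_ C) : Prop where
  mul_left : (μ[H] ⊗ₘ 𝟙 A) ≫ τ =
    𝟙 ((H ⊗ H) ⊗ A) ⊗≫ (𝟙 H ⊗ₘ 𝟙 H ⊗ₘ Δ[A]) ⊗≫ (𝟙 H ⊗ₘ τ ⊗ₘ 𝟙 A) ⊗≫ τ
  mul_right : (𝟙 H ⊗ₘ μ[A]) ≫ τ =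
    (Δ[H] ⊗ₘ 𝟙 A ⊗ₘ 𝟙 A) ⊗≫ (𝟙 H ⊗ₘ (β_ H A).hom ⊗ₘ 𝟙 A) ⊗≫ (τ ⊗ₘ τ) ⊗≫ 𝟙 (𝟙_ C)
  one_right : 𝟙 H ⊗≫ (𝟙 H ⊗ₘ η[A]) ≫ τ = ε[H]
  one_left : 𝟙 A ⊗≫ (η[H] ⊗ₘ 𝟙 A) ≫ τ = ε[A]

/-- The convolution product `σ * τ = (σ ⊗ τ) Δ_{X ⊗ Y}` of two forms on `X ⊗ Y`. -/
def convMul {X Y : C} [ComonObj X] [ComonObj Y] (σ τ : X ⊗ Y ⟶ 𝟙_ C) : X ⊗ Y ⟶ 𝟙_ C :=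
  tensorComul X Y ≫ (σ ⊗ₘ τ) ⊗≫ 𝟙 (𝟙_ C)

/-- `τbar` is the (two-sided, hence unique) convolution inverse of `τ`. -/
structure IsConvInverse {X Y : C} [ComonObj X] [ComonObj Y] (τ τbar : X ⊗ Y ⟶ 𝟙_ C) : Prop where
  mul_inv : convMul τ τbar = tensorCounit X Y
  inv_mul : convMul τbar τ = tensorCounit X Y

/-- The relation `(id_U ⊗ τ) (C_{V,U} ⊗ id_W) = (τ ⊗ id_U) (id_V ⊗ C_{U,W})` of morphisms
`V ⊗ U ⊗ W ⟶ U`. -/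
def SlidesAlong {V W : C} (τ : V ⊗ W ⟶ 𝟙_ C) (U : C) : Prop :=
  𝟙 (V ⊗ U ⊗ W) ⊗≫ ((β_ V U).hom ⊗ₘ 𝟙 W) ⊗≫ (𝟙 U ⊗ₘ τ) ⊗≫ 𝟙 U =
    𝟙 (V ⊗ U ⊗ W) ⊗≫ (𝟙 V ⊗ₘ (β_ U W).hom) ⊗≫ (τ ⊗ₘ 𝟙 U) ⊗≫ 𝟙 U

/-- `τ : V ⊗ W ⟶ I` is symmetric with respect to the braiding. -/
structure IsBraidSymmetric {V W : C} (τ : V ⊗ W ⟶ 𝟙_ C) : Prop where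
  left : SlidesAlong τ V
  right : SlidesAlong τ W

variable {A H : C} [BimonObj A] [BimonObj H]

/-- The map `α : H ⊗ A ⟶ A`, `α(h, a) = τ(h₁, a₁) a₂ τbar(h₂, a₃)`. -/
def leftAct (τ τbar : H ⊗ A ⟶ 𝟙_ C) : H ⊗ A ⟶ A :=
  (Δ[H] ⊗ₘ Δ[A]) ⊗≫ (𝟙 H ⊗ₘ (β_ H A).hom ⊗ₘ Δ[A]) ⊗≫
    (𝟙 H ⊗ₘ 𝟙 A ⊗ₘ (β_ H A).hom ⊗ₘ 𝟙 A) ⊗≫ (τ ⊗ₘ 𝟙 A ⊗ₘ τbar) ⊗≫ 𝟙 A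

/-- The map `β : H ⊗ A ⟶ H`, `β(h, a) = τ(h₁, a₁) h₂ τbar(h₃, a₂)`. -/
def rightAct (τ τbar : H ⊗ A ⟶ 𝟙_ C) : H ⊗ A ⟶ H :=
  (Δ[H] ⊗ₘ Δ[A]) ⊗≫ (Δ[H] ⊗ₘ (β_ H A).hom ⊗ₘ 𝟙 A) ⊗≫
    (𝟙 H ⊗ₘ (β_ H A).hom ⊗ₘ 𝟙 H ⊗ₘ 𝟙 A) ⊗≫ (τ ⊗ₘ 𝟙 H ⊗ₘ τbar) ⊗≫ 𝟙 H

/-- The multiplication of the double cross product of `A` and `H` along `actL : H ⊗ A ⟶ A` and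
`actR : H ⊗ A ⟶ H`, that is
`(m_A ⊗ m_H) (id ⊗ actL ⊗ actR ⊗ id) (id ⊗ id ⊗ C_{H,A} ⊗ id ⊗ id) (id ⊗ Δ_H ⊗ Δ_A ⊗ id)`. -/
def crossMul (actL : H ⊗ A ⟶ A) (actR : H ⊗ A ⟶ H) :
    (A ⊗ H) ⊗ (A ⊗ H) ⟶ A ⊗ H :=
  𝟙 ((A ⊗ H) ⊗ (A ⊗ H)) ⊗≫ (𝟙 A ⊗ₘ Δ[H] ⊗ₘ Δ[A] ⊗ₘ 𝟙 H) ⊗≫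
    (𝟙 A ⊗ₘ 𝟙 H ⊗ₘ (β_ H A).hom ⊗ₘ 𝟙 A ⊗ₘ 𝟙 H) ⊗≫
    (𝟙 A ⊗ₘ actL ⊗ₘ actR ⊗ₘ 𝟙 H) ⊗≫ (μ[A] ⊗ₘ μ[H])

variable (A H) in
/-- The unit `η_A ⊗ η_H` of the double cross product. -/
def crossOne : 𝟙_ C ⟶ A ⊗ H := 𝟙 (𝟙_ C) ⊗≫ (η[A] ⊗ₘ η[H])

/-- `S` is an antipode, i.e. a two-sided convolution inverse of the identity, for the
multiplication `m`, unit `e`, comultiplication `d` and counit `c` on `X`. -/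
structure IsAntipode {X : C} (m : X ⊗ X ⟶ X) (e : 𝟙_ C ⟶ X) (d : X ⟶ X ⊗ X) (c : X ⟶ 𝟙_ C)
    (S : X ⟶ X) : Prop where
  left : d ≫ (S ⊗ₘ 𝟙 X) ≫ m = c ≫ e
  right : d ≫ (𝟙 X ⊗ₘ S) ≫ m = c ≫ e

end

end DoubleCross

/-!
A form `σ` on a coalgebra `Y` acts on `Y` from both sides, by `y ↦ σ(y₁) y₂` (`leftHit`) and by
`y ↦ y₁ σ(y₂)` (`rightHit`). These actions commute and are multiplicative for the convolution
product, so an invertible form yields an automorphism `y ↦ σ(y₁) y₂ σ⁻¹(y₃)` of the coalgebra `Y`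
(`conjHit`, `IsInvForm.isComonHom_conjHit`). For `Y = H ⊗ A` and the skew pairing `τ`, the maps
`α` and `β` are this conjugation followed by the two counit projections, and the inner factors of
`(α ⊗ β) Δ` cancel. Hence the multiplication of the double cross product exchanges `H` and `A` by
`ψ = C_{H,A} ∘ conj_τ` (`twistedSwap`, `crossMul_eq_smashMul`).

The product on `A ⊗ H` along `ψ` is associative and unital as soon as `ψ` is a distributive law
(`smashMonObj`). The braiding is one. That `τ` is a skew pairing means that its pullbacks along the
two multiplications are convolution products of forms that act on two of three tensor factors
(`IsSkewPairing.mul_left_eq`, `IsSkewPairing.mul_right_eq`), so conjugation by them is a composite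
of two conjugations. The one on the outer two factors is moved past the braiding
(`IsInvForm.swapRight_conjHit`, `swapLeft_conjHit`), and this is the only place where the symmetry
of `τ` enters; `IsSkewPairing.isDistributive_twistedSwap` collects the result.

The antipode is `a ⊗ h ↦ S(h) S(a)`, computed in this algebra (`isAntipode_smashMul`). Finally,
`A ⊗ H` is a bialgebra if and only if `ψ` is a coalgebra morphism. Since `conj_τ` is a coalgebra
automorphism, this holds if and only if the braiding `C_{H,A}` is a coalgebra morphism, and the
counits applied to the outer legs of the comultiplication show that this in turn means
`C_{A,H} C_{H,A} = id` (`isComonHom_twistedSwap_iff`).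
-/

namespace DoubleCross

/-! ### Forms on a coalgebra and their convolution -/

section Forms

variable {C : Type u} [Category.{v} C] [MonoidalCategory C]
variable {Y Z : C} [ComonObj Y] [ComonObj Z]

/-- The endomorphism `y ↦ σ(y₁) y₂` of a coalgebra `Y` given by a form `σ` on `Y`. -/
def leftHit (σ : Y ⟶ 𝟙_ C) : Y ⟶ Y := Δ[Y] ≫ σ ▷ Y ≫ (λ_ Y).hom

/-- The endomorphism `y ↦ y₁ σ(y₂)` of a coalgebra `Y` given by a form `σ` on `Y`. -/
def rightHit (σ : Y ⟶ 𝟙_ C) : Y ⟶ Y := Δ[Y] ≫ Y ◁ σ ≫ (ρ_ Y).hom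

@[simp]
lemma leftHit_counit (σ : Y ⟶ 𝟙_ C) : leftHit σ ≫ ε[Y] = σ := by
  have h : σ ▷ Y ≫ (λ_ Y).hom ≫ ε[Y] = Y ◁ ε[Y] ≫ (ρ_ Y).hom ≫ σ := by
    rw [← leftUnitor_naturality, ← rightUnitor_naturality, whisker_exchange_assoc,
      unitors_equal]
  simp [leftHit, h]

@[simp]
lemma rightHit_counit (σ : Y ⟶ 𝟙_ C) : rightHit σ ≫ ε[Y] = σ := by
  have h : Y ◁ σ ≫ (ρ_ Y).hom ≫ ε[Y] = ε[Y] ▷ Y ≫ (λ_ Y).hom ≫ σ := by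
    rw [← leftUnitor_naturality, ← rightUnitor_naturality, whisker_exchange_assoc,
      unitors_equal]
  simp [rightHit, h]

@[simp]
lemma leftHit_of_counit : leftHit ε[Y] = 𝟙 Y := by simp [leftHit]

@[simp]
lemma rightHit_of_counit : rightHit ε[Y] = 𝟙 Y := by simp [rightHit]

lemma leftHit_comul (σ : Y ⟶ 𝟙_ C) : leftHit σ ≫ Δ[Y] = Δ[Y] ≫ leftHit σ ▷ Y := by
  calc leftHit σ ≫ Δ[Y] = (Δ[Y] ≫ Y ◁ Δ[Y]) ≫ σ ▷ (Y ⊗ Y) ≫ (λ_ (Y ⊗ Y)).hom := by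
        simp only [leftHit, Category.assoc]
        rw [whisker_exchange_assoc, leftUnitor_naturality]
    _ = _ := by
        rw [ComonObj.comul_assoc]
        simp only [leftHit]
        monoidal

lemma rightHit_comul (σ : Y ⟶ 𝟙_ C) : rightHit σ ≫ Δ[Y] = Δ[Y] ≫ Y ◁ rightHit σ := by
  calc rightHit σ ≫ Δ[Y] = (Δ[Y] ≫ Δ[Y] ▷ Y) ≫ (Y ⊗ Y) ◁ σ ≫ (ρ_ (Y ⊗ Y)).hom := by
        simp only [rightHit, Category.assoc]
        rw [← whisker_exchange_assoc, rightUnitor_naturality]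
    _ = _ := by
        rw [ComonObj.comul_assoc_flip]
        simp only [rightHit]
        monoidal

/-- The two actions of a form on the inner legs of `y₁ ⊗ y₂` agree: both are
`y₁ σ(y₂) ⊗ y₃`. -/
lemma comul_rightHit_whiskerRight (σ : Y ⟶ 𝟙_ C) :
    Δ[Y] ≫ rightHit σ ▷ Y = Δ[Y] ≫ Y ◁ leftHit σ := by
  have h : Δ[Y] ≫ Δ[Y] ▷ Y = Δ[Y] ≫ Y ◁ Δ[Y] ≫ (α_ Y Y Y).inv := ComonObj.comul_assoc_flip Y
  calc Δ[Y] ≫ rightHit σ ▷ Y = (Δ[Y] ≫ Δ[Y] ▷ Y) ≫ (Y ◁ σ) ▷ Y ≫ (ρ_ Y).hom ▷ Y := by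
        simp [rightHit]
    _ = _ := by
        rw [h]
        simp only [leftHit]
        monoidal

/-- `leftHit σ ≫ σ'` is the convolution product `y ↦ σ(y₁) σ'(y₂)`. -/
lemma comul_tensorHom (σ σ' : Y ⟶ 𝟙_ C) :
    Δ[Y] ≫ (σ ⊗ₘ σ') ≫ (λ_ (𝟙_ C)).hom = leftHit σ ≫ σ' := by
  simp only [leftHit, MonoidalCategory.tensorHom_def, Category.assoc, leftUnitor_naturality]

/-- Both sides are the convolution product of `σ` and `σ'`. -/
lemma leftHit_comp_eq (σ σ' : Y ⟶ 𝟙_ C) : leftHit σ ≫ σ' = rightHit σ' ≫ σ := by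
  rw [← comul_tensorHom, MonoidalCategory.tensorHom_def', unitors_equal]
  simp only [rightHit, Category.assoc, rightUnitor_naturality]

lemma leftHit_comp (σ σ' : Y ⟶ 𝟙_ C) :
    leftHit (leftHit σ ≫ σ') = leftHit σ ≫ leftHit σ' := by
  conv_rhs => rw [leftHit.eq_1 σ', reassoc_of% leftHit_comul]
  simp only [leftHit.eq_1 (leftHit σ ≫ σ'), comp_whiskerRight, Category.assoc]

lemma leftHit_rightHit (σ σ' : Y ⟶ 𝟙_ C) :
    leftHit σ ≫ rightHit σ' = rightHit σ' ≫ leftHit σ := by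
  rw [rightHit, reassoc_of% leftHit_comul, ← whisker_exchange_assoc, rightUnitor_naturality]
  simp

lemma rightHit_comp (σ σ' : Y ⟶ 𝟙_ C) :
    rightHit (leftHit σ ≫ σ') = rightHit σ' ≫ rightHit σ := by
  rw [leftHit_comp_eq]
  conv_rhs => rw [rightHit.eq_1 σ, reassoc_of% rightHit_comul]
  simp only [rightHit.eq_1 (rightHit σ' ≫ σ), MonoidalCategory.whiskerLeft_comp, Category.assoc]

lemma comp_leftHit (f : Z ⟶ Y) [IsComonHom f] (σ : Y ⟶ 𝟙_ C) :
    f ≫ leftHit σ = leftHit (f ≫ σ) ≫ f := by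
  simp only [leftHit, IsComonHom.hom_comul_assoc, MonoidalCategory.tensorHom_def',
    comp_whiskerRight, Category.assoc, ← leftUnitor_naturality, whisker_exchange_assoc]

lemma comp_rightHit (f : Z ⟶ Y) [IsComonHom f] (σ : Y ⟶ 𝟙_ C) :
    f ≫ rightHit σ = rightHit (f ≫ σ) ≫ f := by
  simp only [rightHit, IsComonHom.hom_comul_assoc, MonoidalCategory.tensorHom_def,
    MonoidalCategory.whiskerLeft_comp, Category.assoc, ← rightUnitor_naturality,
    whisker_exchange_assoc]

/-- `σ` and `σ'` are inverse to each other for the convolution product of forms on `Y`. -/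
structure IsInvForm (σ σ' : Y ⟶ 𝟙_ C) : Prop where
  mul_inv : leftHit σ ≫ σ' = ε[Y]
  inv_mul : leftHit σ' ≫ σ = ε[Y]

namespace IsInvForm

variable {σ σ' ρ ρ' : Y ⟶ 𝟙_ C}

lemma symm (h : IsInvForm σ σ') : IsInvForm σ' σ := ⟨h.inv_mul, h.mul_inv⟩

lemma leftHit_leftHit (h : IsInvForm σ σ') : leftHit σ ≫ leftHit σ' = 𝟙 Y := by
  rw [← leftHit_comp, h.mul_inv, leftHit_of_counit]

lemma rightHit_rightHit (h : IsInvForm σ σ') : rightHit σ ≫ rightHit σ' = 𝟙 Y := by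
  rw [← rightHit_comp, h.inv_mul, rightHit_of_counit]

lemma unique (h : IsInvForm σ σ') (h' : IsInvForm σ ρ) : σ' = ρ := by
  calc σ' = leftHit σ' ≫ leftHit σ ≫ ρ := by rw [h'.mul_inv, leftHit_counit]
    _ = ρ := (reassoc_of% h.symm.leftHit_leftHit) ρ

lemma mul (h : IsInvForm σ σ') (k : IsInvForm ρ ρ') :
    IsInvForm (leftHit σ ≫ ρ) (leftHit ρ' ≫ σ') where
  mul_inv := by rw [leftHit_comp, Category.assoc, reassoc_of% k.leftHit_leftHit, h.mul_inv]
  inv_mul := by rw [leftHit_comp, Category.assoc, reassoc_of% h.symm.leftHit_leftHit, k.inv_mul]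

lemma comp (h : IsInvForm σ σ') (f : Z ⟶ Y) [IsComonHom f] :
    IsInvForm (f ≫ σ) (f ≫ σ') where
  mul_inv := by rw [← reassoc_of% comp_leftHit, h.mul_inv, IsComonHom.hom_counit]
  inv_mul := by rw [← reassoc_of% comp_leftHit, h.inv_mul, IsComonHom.hom_counit]

lemma eq_counit (h : IsInvForm ε[Y] σ) : σ = ε[Y] := by
  simpa using h.mul_inv

end IsInvForm

/-- The endomorphism `y ↦ σ(y₁) y₂ σ'(y₃)` of a coalgebra `Y`. -/
def conjHit (σ σ' : Y ⟶ 𝟙_ C) : Y ⟶ Y := leftHit σ ≫ rightHit σ'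

lemma comp_conjHit (f : Z ⟶ Y) [IsComonHom f] (σ σ' : Y ⟶ 𝟙_ C) :
    f ≫ conjHit σ σ' = conjHit (f ≫ σ) (f ≫ σ') ≫ f := by
  simp only [conjHit, reassoc_of% comp_leftHit, comp_rightHit, Category.assoc]

/-- A coalgebra morphism along which `σ` becomes trivial does not see the conjugation by `σ`. -/
lemma comp_conjHit_of_comp_eq_counit {σ σ' : Y ⟶ 𝟙_ C}
    (h : IsInvForm σ σ') (f : Z ⟶ Y) [IsComonHom f] (hf : f ≫ σ = ε[Z]) :
    f ≫ conjHit σ σ' = f := by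
  have hf' : f ≫ σ' = ε[Z] := IsInvForm.eq_counit (hf ▸ h.comp f)
  rw [comp_conjHit, hf, hf', conjHit]
  simp

/-- Conjugation by a convolution product is the composite of the conjugations. The second argument
is a product in the reversed order, as it is for inverses. -/
lemma conjHit_mul (σ σ' ρ ρ' : Y ⟶ 𝟙_ C) :
    conjHit (leftHit σ ≫ ρ) (leftHit ρ' ≫ σ') = conjHit σ σ' ≫ conjHit ρ ρ' := by
  simp only [conjHit, leftHit_comp, rightHit_comp, Category.assoc, reassoc_of% leftHit_rightHit]

lemma IsInvForm.conjHit_conjHit {σ σ' : Y ⟶ 𝟙_ C} (h : IsInvForm σ σ') :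
    conjHit σ σ' ≫ conjHit σ' σ = 𝟙 Y := by
  rw [← conjHit_mul, h.mul_inv, conjHit, leftHit_of_counit, rightHit_of_counit, Category.comp_id]

/-- In `σ(y₁) f(y₂) σ'(y₃) ⊗ σ(y₄) g(y₅) σ'(y₆)` the two inner factors cancel, which leaves
`σ(y₁) f(y₂) ⊗ g(y₃) σ'(y₄)`. -/
lemma IsInvForm.comul_conjHit {σ σ' : Y ⟶ 𝟙_ C} (h : IsInvForm σ σ') {P Q : C} (f : Y ⟶ P)
    (g : Y ⟶ Q) : Δ[Y] ≫ (conjHit σ σ' ≫ f ⊗ₘ conjHit σ σ' ≫ g) =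
      conjHit σ σ' ≫ Δ[Y] ≫ (f ⊗ₘ g) := by
  rw [← tensorHom_comp_tensorHom]
  simp only [← Category.assoc]
  congr 1
  calc Δ[Y] ≫ (conjHit σ σ' ⊗ₘ conjHit σ σ')
      = (Δ[Y] ≫ leftHit σ ▷ Y) ≫ rightHit σ' ▷ Y ≫ Y ◁ conjHit σ σ' := by
        simp only [MonoidalCategory.tensorHom_def, conjHit.eq_1 σ σ', comp_whiskerRight,
          Category.assoc]
    _ = leftHit σ ≫ Δ[Y] ≫ Y ◁ (leftHit σ' ≫ leftHit σ ≫ rightHit σ') := by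
        rw [← leftHit_comul, Category.assoc, reassoc_of% comul_rightHit_whiskerRight]
        simp only [conjHit, MonoidalCategory.whiskerLeft_comp]
    _ = conjHit σ σ' ≫ Δ[Y] := by
        rw [reassoc_of% h.symm.leftHit_leftHit, ← rightHit_comul, conjHit, Category.assoc]

lemma IsInvForm.isComonHom_conjHit {σ σ' : Y ⟶ 𝟙_ C} (h : IsInvForm σ σ') :
    IsComonHom (conjHit σ σ') where
  hom_counit := by rw [conjHit, Category.assoc, rightHit_counit, h.mul_inv]
  hom_comul := by simpa using (h.comul_conjHit (𝟙 Y) (𝟙 Y)).symm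

end Forms

/-! ### Tensor products of coalgebras -/

section TensorCoalgebra

variable {C : Type u} [Category.{v} C] [MonoidalCategory C] [BraidedCategory C]

lemma isComonHom_tensorHom {X X' Y Y' : C} [ComonObj X] [ComonObj X'] [ComonObj Y] [ComonObj Y']
    (f : X ⟶ X') (g : Y ⟶ Y') [IsComonHom f] [IsComonHom g] : IsComonHom (f ⊗ₘ g) :=
  let f' : Comon.mk X ⟶ Comon.mk X' := Comon.Hom.mk f
  let g' : Comon.mk Y ⟶ Comon.mk Y' := Comon.Hom.mk g
  Comon.monoidal_tensorHom_hom C f' g' ▸ (f' ⊗ₘ g').isComonHom_hom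

instance isComonHom_whiskerRight {X X' : C} [ComonObj X] [ComonObj X'] (f : X ⟶ X')
    [IsComonHom f] (Y : C) [ComonObj Y] : IsComonHom (f ▷ Y) := by
  rw [← tensorHom_id]
  exact isComonHom_tensorHom f (𝟙 Y)

instance isComonHom_whiskerLeft (X : C) [ComonObj X] {Y Y' : C} [ComonObj Y] [ComonObj Y']
    (f : Y ⟶ Y') [IsComonHom f] : IsComonHom (X ◁ f) := by
  rw [← id_tensorHom]
  exact isComonHom_tensorHom (𝟙 X) f

instance isComonHom_associator (X Y Z : C) [ComonObj X] [ComonObj Y] [ComonObj Z] :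
    IsComonHom (α_ X Y Z).hom :=
  let α : (Comon.mk X ⊗ Comon.mk Y) ⊗ Comon.mk Z ⟶ Comon.mk X ⊗ Comon.mk Y ⊗ Comon.mk Z :=
    (α_ _ _ _).hom
  have h : α.hom = (α_ X Y Z).hom :=
    (Comon.monoidal_associator_hom_hom C _ _ _).trans <| by
      -- The monoidal structure of `Comon C` is transported, which leaves identity whiskerings.
      change 𝟙 (X ⊗ Y) ▷ Z ≫ (α_ X Y Z).hom ≫ X ◁ 𝟙 (Y ⊗ Z) = (α_ X Y Z).hom
      simp
  h ▸ α.isComonHom_hom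

variable (X Y : C) [ComonObj X] [ComonObj Y]

/-- The projection `ε ⊗ id` of `X ⊗ Y` to the coalgebra `Y`. -/
def counitFst : X ⊗ Y ⟶ Y := ε[X] ▷ Y ≫ (λ_ Y).hom

/-- The projection `id ⊗ ε` of `X ⊗ Y` to the coalgebra `X`. -/
def counitSnd : X ⊗ Y ⟶ X := X ◁ ε[Y] ≫ (ρ_ X).hom

lemma tensorObj_comul_eq :
    Δ[X ⊗ Y] = Δ[X] ▷ Y ≫ (X ⊗ X) ◁ Δ[Y] ⊗≫ X ◁ (β_ X Y).hom ▷ Y ⊗≫ 𝟙 _ := by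
  simp only [Comon.tensorObj_comul, tensorμ, MonoidalCategory.tensorHom_def]
  monoidal

lemma comul_counitSnd_whiskerRight :
    Δ[X ⊗ Y] ≫ counitSnd X Y ▷ (X ⊗ Y) = Δ[X] ▷ Y ≫ (α_ X X Y).hom := by
  calc _ = Δ[X] ▷ Y ≫ (X ⊗ X) ◁ Δ[Y] ⊗≫ X ◁ ((β_ X Y).hom ≫ ε[Y] ▷ X) ▷ Y ⊗≫ 𝟙 _ := by
        rw [tensorObj_comul_eq, counitSnd]; monoidal
    _ = Δ[X] ▷ Y ⊗≫ (X ⊗ X) ◁ (Δ[Y] ≫ ε[Y] ▷ Y) ⊗≫ 𝟙 _ := by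
        rw [← BraidedCategory.braiding_naturality_right, braiding_tensorUnit_right]; monoidal
    _ = _ := by rw [ComonObj.counit_comul]; monoidal

lemma comul_whiskerLeft_counitFst :
    Δ[X ⊗ Y] ≫ (X ⊗ Y) ◁ counitFst X Y = X ◁ Δ[Y] ≫ (α_ X Y Y).inv := by
  calc _ = (Δ[X] ▷ Y ≫ (X ⊗ X) ◁ Δ[Y]) ⊗≫ X ◁ ((β_ X Y).hom ≫ Y ◁ ε[X]) ▷ Y ⊗≫ 𝟙 _ := by
        rw [tensorObj_comul_eq, counitFst]
        calc _ = Δ[X] ▷ Y ≫ (X ⊗ X) ◁ Δ[Y] ⊗≫ X ◁ (β_ X Y).hom ▷ Y ⊗≫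
              (X ⊗ Y) ◁ ε[X] ▷ Y ⊗≫ 𝟙 _ := by monoidal
          _ = _ := by monoidal
    _ = X ◁ Δ[Y] ⊗≫ (Δ[X] ≫ X ◁ ε[X]) ▷ (Y ⊗ Y) ⊗≫ 𝟙 _ := by
        rw [← whisker_exchange, ← BraidedCategory.braiding_naturality_left,
          braiding_tensorUnit_left]
        monoidal
    _ = _ := by rw [ComonObj.comul_counit]; monoidal

lemma comul_counitFst_whiskerRight :
    Δ[X ⊗ Y] ≫ counitFst X Y ▷ (X ⊗ Y) =
      X ◁ Δ[Y] ≫ (α_ X Y Y).inv ≫ (β_ X Y).hom ▷ Y ≫ (α_ Y X Y).hom := by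
  calc _ = (Δ[X] ▷ Y ≫ (X ⊗ X) ◁ Δ[Y]) ⊗≫ (X ◁ (β_ X Y).hom ≫ ε[X] ▷ (Y ⊗ X)) ▷ Y ⊗≫
        𝟙 _ := by
        rw [tensorObj_comul_eq, counitFst]; monoidal
    _ = X ◁ Δ[Y] ⊗≫ (Δ[X] ≫ ε[X] ▷ X) ▷ (Y ⊗ Y) ⊗≫ (β_ X Y).hom ▷ Y ⊗≫ 𝟙 _ := by
        rw [whisker_exchange, ← whisker_exchange]; monoidal
    _ = _ := by rw [ComonObj.counit_comul]; monoidal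

lemma comul_whiskerLeft_counitSnd :
    Δ[X ⊗ Y] ≫ (X ⊗ Y) ◁ counitSnd X Y =
      Δ[X] ▷ Y ≫ (α_ X X Y).hom ≫ X ◁ (β_ X Y).hom ≫ (α_ X Y X).inv := by
  calc _ = Δ[X] ▷ Y ≫ (X ⊗ X) ◁ Δ[Y] ⊗≫ X ◁ ((β_ X Y).hom ▷ Y ≫ (Y ⊗ X) ◁ ε[Y]) ⊗≫ 𝟙 _ := by
        rw [tensorObj_comul_eq, counitSnd]
        monoidal
    _ = Δ[X] ▷ Y ≫ (X ⊗ X) ◁ (Δ[Y] ≫ Y ◁ ε[Y]) ⊗≫ X ◁ (β_ X Y).hom ⊗≫ 𝟙 _ := by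
        rw [← whisker_exchange]
        monoidal
    _ = _ := by rw [ComonObj.comul_counit]; monoidal

instance isComonHom_counitFst : IsComonHom (counitFst X Y) where
  hom_counit := by simp [counitFst, MonoidalCategory.tensorHom_def]
  hom_comul := by
    rw [MonoidalCategory.tensorHom_def', reassoc_of% comul_whiskerLeft_counitFst]
    simp only [counitFst, Category.assoc, comp_whiskerRight]
    rw [← leftUnitor_naturality, ← whisker_exchange_assoc]
    monoidal

instance isComonHom_counitSnd : IsComonHom (counitSnd X Y) where
  hom_counit := by simp [counitSnd, MonoidalCategory.tensorHom_def', unitors_equal]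
  hom_comul := by
    rw [MonoidalCategory.tensorHom_def, reassoc_of% comul_counitSnd_whiskerRight]
    simp only [counitSnd, Category.assoc, MonoidalCategory.whiskerLeft_comp]
    rw [← rightUnitor_naturality, whisker_exchange_assoc]
    monoidal

/-- The two projections, taken in the opposite order, recover the braiding. -/
lemma comul_counitFst_tensorHom_counitSnd :
    Δ[X ⊗ Y] ≫ (counitFst X Y ⊗ₘ counitSnd X Y) = (β_ X Y).hom := by
  rw [MonoidalCategory.tensorHom_def, reassoc_of% comul_counitFst_whiskerRight, counitSnd]
  calc _ = X ◁ Δ[Y] ⊗≫ ((β_ X Y).hom ▷ Y ≫ (Y ⊗ X) ◁ ε[Y]) ⊗≫ 𝟙 _ := by monoidal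
    _ = X ◁ (Δ[Y] ≫ Y ◁ ε[Y]) ⊗≫ (β_ X Y).hom ⊗≫ 𝟙 _ := by
        rw [← whisker_exchange]; monoidal
    _ = _ := by rw [ComonObj.comul_counit]; monoidal

variable {X Y}

lemma leftHit_counitFst (σ : Y ⟶ 𝟙_ C) :
    leftHit (counitFst X Y ≫ σ) = X ◁ leftHit σ := by
  rw [leftHit, comp_whiskerRight_assoc, reassoc_of% comul_counitFst_whiskerRight]
  calc _ = X ◁ Δ[Y] ⊗≫ ((β_ X Y).hom ≫ σ ▷ X) ▷ Y ⊗≫ 𝟙 _ := by monoidal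
    _ = _ := by
      rw [← BraidedCategory.braiding_naturality_right, braiding_tensorUnit_right, leftHit]
      monoidal

lemma rightHit_counitFst (σ : Y ⟶ 𝟙_ C) :
    rightHit (counitFst X Y ≫ σ) = X ◁ rightHit σ := by
  rw [rightHit, MonoidalCategory.whiskerLeft_comp_assoc, reassoc_of% comul_whiskerLeft_counitFst,
    rightHit]
  monoidal

lemma leftHit_counitSnd (σ : X ⟶ 𝟙_ C) :
    leftHit (counitSnd X Y ≫ σ) = leftHit σ ▷ Y := by
  rw [leftHit, comp_whiskerRight_assoc, reassoc_of% comul_counitSnd_whiskerRight, leftHit]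
  monoidal

lemma rightHit_counitSnd (σ : X ⟶ 𝟙_ C) :
    rightHit (counitSnd X Y ≫ σ) = rightHit σ ▷ Y := by
  rw [rightHit, MonoidalCategory.whiskerLeft_comp_assoc, reassoc_of% comul_whiskerLeft_counitSnd]
  calc _ = Δ[X] ▷ Y ⊗≫ X ◁ ((β_ X Y).hom ≫ Y ◁ σ) ⊗≫ 𝟙 _ := by monoidal
    _ = _ := by
      rw [← BraidedCategory.braiding_naturality_left, braiding_tensorUnit_left, rightHit]
      monoidal

lemma conjHit_counitFst (σ σ' : Y ⟶ 𝟙_ C) :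
    conjHit (counitFst X Y ≫ σ) (counitFst X Y ≫ σ') = X ◁ conjHit σ σ' := by
  simp only [conjHit, leftHit_counitFst, rightHit_counitFst, MonoidalCategory.whiskerLeft_comp]

lemma conjHit_counitSnd (σ σ' : X ⟶ 𝟙_ C) :
    conjHit (counitSnd X Y ≫ σ) (counitSnd X Y ≫ σ') = conjHit σ σ' ▷ Y := by
  simp only [conjHit, leftHit_counitSnd, rightHit_counitSnd, comp_whiskerRight]

lemma tensorComul_eq_comul : tensorComul X Y = Δ[X ⊗ Y] := by
  rw [tensorObj_comul_eq, tensorComul]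
  simp only [MonoidalCategory.tensorHom_def]
  monoidal

lemma tensorCounit_eq_counit : tensorCounit X Y = ε[X ⊗ Y] := by
  simp [tensorCounit, monoidalComp]

/-- The failure of the braiding to commute with the comultiplications is a double braiding of the
two inner legs. -/
lemma braiding_comul :
    (β_ X Y).hom ≫ Δ[Y ⊗ X] = Δ[X ⊗ Y] ≫ ((β_ X Y).hom ⊗ₘ (β_ X Y).hom) ⊗≫
      Y ◁ ((β_ X Y).hom ≫ (β_ Y X).hom) ▷ X ⊗≫ 𝟙 _ := by
  calc _ = ((β_ X Y).hom ≫ (Δ[Y] ⊗ₘ Δ[X])) ⊗≫ Y ◁ (β_ Y X).hom ▷ X ⊗≫ 𝟙 _ := by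
        rw [tensorObj_comul_eq, MonoidalCategory.tensorHom_def]; monoidal
    _ = _ := by
        rw [← BraidedCategory.braiding_naturality, tensorObj_comul_eq]
        simp only [BraidedCategory.braiding_tensor_left_hom,
          BraidedCategory.braiding_tensor_right_hom, MonoidalCategory.tensorHom_def]
        monoidal

lemma isComonHom_braiding (h : (β_ X Y).hom ≫ (β_ Y X).hom = 𝟙 (X ⊗ Y)) :
    IsComonHom (β_ X Y).hom where
  hom_counit := by
    simp only [Comon.tensorObj_counit]
    rw [← BraidedCategory.braiding_naturality_assoc, braiding_tensorUnit_left]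
    simp [unitors_equal]
  hom_comul := by
    rw [braiding_comul, h]
    monoidal

/-- The counits on the two outer legs of `braiding_comul` isolate the double braiding. -/
lemma braiding_braiding_of_isComonHom (h : IsComonHom (β_ X Y).hom) :
    (β_ X Y).hom ≫ (β_ Y X).hom = 𝟙 (X ⊗ Y) := by
  have h₁ : (β_ X Y).hom ≫ counitFst Y X = counitSnd X Y := by
    rw [counitFst, ← BraidedCategory.braiding_naturality_right_assoc, braiding_leftUnitor,
      counitSnd]
  have h₂ : (β_ X Y).hom ≫ counitSnd Y X = counitFst X Y := by
    rw [counitSnd, ← BraidedCategory.braiding_naturality_left_assoc, braiding_rightUnitor,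
      counitFst]
  rw [← comul_counitFst_tensorHom_counitSnd Y X, h.hom_comul_assoc, tensorHom_comp_tensorHom,
    h₁, h₂, MonoidalCategory.tensorHom_def, reassoc_of% comul_counitSnd_whiskerRight]
  calc _ = Δ[X] ▷ Y ⊗≫ X ◁ ε[X] ▷ Y ⊗≫ 𝟙 _ := by rw [counitFst]; monoidal
    _ = (Δ[X] ≫ X ◁ ε[X]) ▷ Y ⊗≫ 𝟙 _ := by monoidal
    _ = _ := by rw [ComonObj.comul_counit]; monoidal

end TensorCoalgebra

/-! ### Sliding strands across a comultiplication or a form -/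

section BraidingNaturality

variable {C : Type u} [Category.{v} C] [MonoidalCategory C] [BraidedCategory C]

lemma braiding_comul_whiskerRight (V A : C) [ComonObj A] :
    (β_ V A).hom ≫ Δ[A] ▷ V = V ◁ Δ[A] ⊗≫ (β_ V A).hom ▷ A ⊗≫ A ◁ (β_ V A).hom ⊗≫ 𝟙 _ := by
  rw [← BraidedCategory.braiding_naturality_right, BraidedCategory.braiding_tensor_right_hom]
  monoidal

lemma braiding_whiskerLeft_comul (H V : C) [ComonObj H] :
    (β_ H V).hom ≫ V ◁ Δ[H] = Δ[H] ▷ V ⊗≫ H ◁ (β_ H V).hom ⊗≫ (β_ H V).hom ▷ H ⊗≫ 𝟙 _ := by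
  rw [← BraidedCategory.braiding_naturality_left, BraidedCategory.braiding_tensor_left_hom]
  monoidal

lemma SlidesAlong.whiskerLeft_braiding {H V A : C} {σ : H ⊗ A ⟶ 𝟙_ C} (hσ : SlidesAlong σ V) :
    H ◁ (β_ V A).hom ⊗≫ σ ▷ V ⊗≫ 𝟙 V =
      𝟙 (H ⊗ V ⊗ A) ⊗≫ (β_ H V).hom ▷ A ⊗≫ V ◁ σ ⊗≫ 𝟙 V := by
  have h := hσ.symm
  simp only [id_tensorHom, tensorHom_id] at h
  calc _ = 𝟙 (H ⊗ V ⊗ A) ⊗≫ H ◁ (β_ V A).hom ⊗≫ σ ▷ V ⊗≫ 𝟙 V := by monoidal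
    _ = _ := h

end BraidingNaturality

/-! ### Forms on the outer legs of a triple tensor product -/

section OuterLegs

variable {C : Type u} [Category.{v} C] [MonoidalCategory C] [BraidedCategory C]
variable {H V A : C} [ComonObj H] [ComonObj V] [ComonObj A]

lemma leftHit_tensor (σ : H ⊗ A ⟶ 𝟙_ C) :
    leftHit σ = Δ[H] ▷ A ≫ (H ⊗ H) ◁ Δ[A] ⊗≫ H ◁ (β_ H A).hom ▷ A ⊗≫ σ ▷ (H ⊗ A) ⊗≫
      𝟙 (H ⊗ A) := by
  rw [leftHit, tensorObj_comul_eq]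
  monoidal

lemma rightHit_tensor (σ : H ⊗ A ⟶ 𝟙_ C) :
    rightHit σ = Δ[H] ▷ A ≫ (H ⊗ H) ◁ Δ[A] ⊗≫ H ◁ (β_ H A).hom ▷ A ⊗≫ (H ⊗ A) ◁ σ ⊗≫
      𝟙 (H ⊗ A) := by
  rw [rightHit, tensorObj_comul_eq]
  monoidal

variable (V) in
/-- The form `h ⊗ v ⊗ a ↦ ε(v) σ(h, a)`. -/
def outerForm (σ : H ⊗ A ⟶ 𝟙_ C) : H ⊗ V ⊗ A ⟶ 𝟙_ C := H ◁ counitFst V A ≫ σ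

lemma leftHit_outerForm (σ : H ⊗ A ⟶ 𝟙_ C) :
    leftHit (outerForm V σ) = Δ[H] ▷ (V ⊗ A) ≫ (H ⊗ H) ◁ V ◁ Δ[A] ⊗≫
      (H ⊗ H) ◁ (β_ V A).hom ▷ A ⊗≫ H ◁ (β_ H A).hom ▷ (V ⊗ A) ⊗≫ σ ▷ (H ⊗ V ⊗ A) ⊗≫
      𝟙 (H ⊗ V ⊗ A) := by
  calc _ = Δ[H] ▷ (V ⊗ A) ≫ (H ⊗ H) ◁ Δ[V ⊗ A] ⊗≫
        H ◁ ((β_ H (V ⊗ A)).hom ≫ counitFst V A ▷ H) ▷ (V ⊗ A) ⊗≫ σ ▷ (H ⊗ V ⊗ A) ⊗≫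
        𝟙 (H ⊗ V ⊗ A) := by
        rw [leftHit_tensor, outerForm]
        monoidal
    _ = Δ[H] ▷ (V ⊗ A) ≫ (H ⊗ H) ◁ (Δ[V ⊗ A] ≫ counitFst V A ▷ (V ⊗ A)) ⊗≫
        H ◁ (β_ H A).hom ▷ (V ⊗ A) ⊗≫ σ ▷ (H ⊗ V ⊗ A) ⊗≫ 𝟙 (H ⊗ V ⊗ A) := by
        rw [← BraidedCategory.braiding_naturality_right]
        monoidal
    _ = _ := by
        rw [comul_counitFst_whiskerRight]
        monoidal

lemma rightHit_outerForm (σ : H ⊗ A ⟶ 𝟙_ C) :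
    rightHit (outerForm V σ) = Δ[H] ▷ (V ⊗ A) ≫ (H ⊗ H) ◁ V ◁ Δ[A] ⊗≫
      H ◁ (β_ H V).hom ▷ (A ⊗ A) ⊗≫ (H ⊗ V) ◁ (β_ H A).hom ▷ A ⊗≫ (H ⊗ V ⊗ A) ◁ σ ⊗≫
      𝟙 (H ⊗ V ⊗ A) := by
  calc _ = Δ[H] ▷ (V ⊗ A) ≫ (H ⊗ H) ◁ Δ[V ⊗ A] ⊗≫
        H ◁ ((β_ H (V ⊗ A)).hom ▷ (V ⊗ A) ≫ ((V ⊗ A) ⊗ H) ◁ counitFst V A) ⊗≫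
        (H ⊗ V ⊗ A) ◁ σ ⊗≫ 𝟙 (H ⊗ V ⊗ A) := by
        rw [rightHit_tensor, outerForm]
        monoidal
    _ = Δ[H] ▷ (V ⊗ A) ≫ (H ⊗ H) ◁ (Δ[V ⊗ A] ≫ (V ⊗ A) ◁ counitFst V A) ⊗≫
        H ◁ (β_ H (V ⊗ A)).hom ▷ A ⊗≫ (H ⊗ V ⊗ A) ◁ σ ⊗≫ 𝟙 (H ⊗ V ⊗ A) := by
        rw [← whisker_exchange]
        monoidal
    _ = _ := by
        rw [comul_whiskerLeft_counitFst, BraidedCategory.braiding_tensor_right_hom]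
        monoidal

variable (H V A) in
/-- The morphism `h ⊗ v ⊗ a ↦ (h ⊗ a) ⊗ v` given by the braiding. -/
def swapRight : H ⊗ V ⊗ A ⟶ (H ⊗ A) ⊗ V := H ◁ (β_ V A).hom ≫ (α_ H A V).inv

variable (H V A) in
/-- The morphism `h ⊗ v ⊗ a ↦ v ⊗ (h ⊗ a)` given by the braiding. -/
def swapLeft : H ⊗ V ⊗ A ⟶ V ⊗ (H ⊗ A) := (α_ H V A).inv ≫ (β_ H V).hom ▷ A ≫ (α_ V H A).hom

/-- No symmetry of `σ` is needed: on both sides it is the leg in `A` absorbed by `σ` that crosses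
`V`, in the same way. -/
lemma swapRight_leftHit (σ : H ⊗ A ⟶ 𝟙_ C) :
    swapRight H V A ≫ leftHit σ ▷ V = leftHit (outerForm V σ) ≫ swapRight H V A := by
  calc _ = (H ◁ (β_ V A).hom ≫ Δ[H] ▷ (A ⊗ V)) ⊗≫ (H ⊗ H) ◁ Δ[A] ▷ V ⊗≫
        H ◁ (β_ H A).hom ▷ (A ⊗ V) ⊗≫ σ ▷ (H ⊗ A ⊗ V) ⊗≫ 𝟙 ((H ⊗ A) ⊗ V) := by
        rw [leftHit_tensor, swapRight]
        monoidal
    _ = Δ[H] ▷ (V ⊗ A) ≫ (H ⊗ H) ◁ ((β_ V A).hom ≫ Δ[A] ▷ V) ⊗≫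
        H ◁ (β_ H A).hom ▷ (A ⊗ V) ⊗≫ σ ▷ (H ⊗ A ⊗ V) ⊗≫ 𝟙 ((H ⊗ A) ⊗ V) := by
        rw [whisker_exchange]
        monoidal
    _ = Δ[H] ▷ (V ⊗ A) ≫ (H ⊗ H) ◁ V ◁ Δ[A] ⊗≫ (H ⊗ H) ◁ (β_ V A).hom ▷ A ⊗≫
        H ◁ ((H ⊗ A) ◁ (β_ V A).hom ≫ (β_ H A).hom ▷ (A ⊗ V)) ⊗≫ σ ▷ (H ⊗ A ⊗ V) ⊗≫
        𝟙 ((H ⊗ A) ⊗ V) := by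
        rw [braiding_comul_whiskerRight]
        monoidal
    _ = Δ[H] ▷ (V ⊗ A) ≫ (H ⊗ H) ◁ V ◁ Δ[A] ⊗≫ (H ⊗ H) ◁ (β_ V A).hom ▷ A ⊗≫
        H ◁ (β_ H A).hom ▷ (V ⊗ A) ⊗≫ ((H ⊗ A) ◁ H ◁ (β_ V A).hom ≫ σ ▷ (H ⊗ A ⊗ V)) ⊗≫
        𝟙 ((H ⊗ A) ⊗ V) := by
        rw [whisker_exchange]
        monoidal
    _ = _ := by
        rw [whisker_exchange, leftHit_outerForm, swapRight]
        monoidal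

/-- The mirror image of `swapRight_leftHit`, again without symmetry of `σ`. -/
lemma swapLeft_rightHit (σ : H ⊗ A ⟶ 𝟙_ C) :
    swapLeft H V A ≫ V ◁ rightHit σ = rightHit (outerForm V σ) ≫ swapLeft H V A := by
  calc _ = 𝟙 _ ⊗≫ ((β_ H V).hom ≫ V ◁ Δ[H]) ▷ A ⊗≫ (V ⊗ H ⊗ H) ◁ Δ[A] ⊗≫
        (V ⊗ H) ◁ (β_ H A).hom ▷ A ⊗≫ (V ⊗ H ⊗ A) ◁ σ ⊗≫ 𝟙 (V ⊗ H ⊗ A) := by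
        rw [rightHit_tensor, swapLeft]
        monoidal
    _ = Δ[H] ▷ (V ⊗ A) ⊗≫ (((H ◁ (β_ H V).hom) ⊗≫ (β_ H V).hom ▷ H ⊗≫ 𝟙 (V ⊗ H ⊗ H)) ▷ A ≫
        (V ⊗ H ⊗ H) ◁ Δ[A]) ⊗≫
        (V ⊗ H) ◁ (β_ H A).hom ▷ A ⊗≫ (V ⊗ H ⊗ A) ◁ σ ⊗≫ 𝟙 (V ⊗ H ⊗ A) := by
        rw [braiding_whiskerLeft_comul]
        monoidal
    _ = Δ[H] ▷ (V ⊗ A) ≫ (H ⊗ H) ◁ V ◁ Δ[A] ⊗≫ H ◁ (β_ H V).hom ▷ (A ⊗ A) ⊗≫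
        (((β_ H V).hom ▷ (H ⊗ A) ≫ (V ⊗ H) ◁ (β_ H A).hom) ▷ A) ⊗≫ (V ⊗ H ⊗ A) ◁ σ ⊗≫
        𝟙 (V ⊗ H ⊗ A) := by
        rw [← whisker_exchange]
        monoidal
    _ = Δ[H] ▷ (V ⊗ A) ≫ (H ⊗ H) ◁ V ◁ Δ[A] ⊗≫ H ◁ (β_ H V).hom ▷ (A ⊗ A) ⊗≫
        (H ⊗ V) ◁ (β_ H A).hom ▷ A ⊗≫ (((β_ H V).hom ▷ A) ▷ (H ⊗ A) ≫ ((V ⊗ H) ⊗ A) ◁ σ) ⊗≫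
        𝟙 (V ⊗ H ⊗ A) := by
        rw [← whisker_exchange]
        monoidal
    _ = _ := by
        rw [← whisker_exchange, rightHit_outerForm, swapLeft]
        monoidal

/-- On one side `V` passes the pair absorbed by `σ` across its leg in `A`, on the other across its
leg in `H`. The sliding relation identifies the two, up to the Yang-Baxter equation. -/
lemma swapRight_rightHit {σ : H ⊗ A ⟶ 𝟙_ C} (hσ : SlidesAlong σ V) :
    swapRight H V A ≫ rightHit σ ▷ V = rightHit (outerForm V σ) ≫ swapRight H V A := by
  calc _ = (H ◁ (β_ V A).hom ≫ Δ[H] ▷ (A ⊗ V)) ⊗≫ (H ⊗ H) ◁ Δ[A] ▷ V ⊗≫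
        H ◁ (β_ H A).hom ▷ (A ⊗ V) ⊗≫ (H ⊗ A) ◁ σ ▷ V ⊗≫ 𝟙 ((H ⊗ A) ⊗ V) := by
        rw [rightHit_tensor, swapRight]
        monoidal
    _ = Δ[H] ▷ (V ⊗ A) ≫ (H ⊗ H) ◁ ((β_ V A).hom ≫ Δ[A] ▷ V) ⊗≫
        H ◁ (β_ H A).hom ▷ (A ⊗ V) ⊗≫ (H ⊗ A) ◁ σ ▷ V ⊗≫ 𝟙 ((H ⊗ A) ⊗ V) := by
        rw [whisker_exchange]
        monoidal
    _ = Δ[H] ▷ (V ⊗ A) ≫ (H ⊗ H) ◁ V ◁ Δ[A] ⊗≫ (H ⊗ H) ◁ (β_ V A).hom ▷ A ⊗≫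
        H ◁ ((H ⊗ A) ◁ (β_ V A).hom ≫ (β_ H A).hom ▷ (A ⊗ V)) ⊗≫ (H ⊗ A) ◁ σ ▷ V ⊗≫
        𝟙 ((H ⊗ A) ⊗ V) := by
        rw [braiding_comul_whiskerRight]
        monoidal
    _ = Δ[H] ▷ (V ⊗ A) ≫ (H ⊗ H) ◁ V ◁ Δ[A] ⊗≫ (H ⊗ H) ◁ (β_ V A).hom ▷ A ⊗≫
        H ◁ (β_ H A).hom ▷ (V ⊗ A) ⊗≫ (H ⊗ A) ◁ (H ◁ (β_ V A).hom ⊗≫ σ ▷ V ⊗≫ 𝟙 V) ⊗≫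
        𝟙 ((H ⊗ A) ⊗ V) := by
        rw [whisker_exchange]
        monoidal
    _ = Δ[H] ▷ (V ⊗ A) ≫ (H ⊗ H) ◁ V ◁ Δ[A] ⊗≫
        H ◁ (𝟙 (H ⊗ V ⊗ A) ⊗≫ (H ◁ (β_ V A).hom ⊗≫ (β_ H A).hom ▷ V ⊗≫
          A ◁ (β_ H V).hom) ⊗≫ 𝟙 ((A ⊗ V) ⊗ H)) ▷ A ⊗≫
        (H ⊗ A ⊗ V) ◁ σ ⊗≫ 𝟙 ((H ⊗ A) ⊗ V) := by
        rw [hσ.whiskerLeft_braiding]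
        monoidal
    _ = Δ[H] ▷ (V ⊗ A) ≫ (H ⊗ H) ◁ V ◁ Δ[A] ⊗≫
        H ◁ ((β_ H V).hom ▷ A ⊗≫ V ◁ (β_ H A).hom) ▷ A ⊗≫
        H ◁ ((β_ V A).hom ▷ (H ⊗ A) ≫ (A ⊗ V) ◁ σ) ⊗≫ 𝟙 ((H ⊗ A) ⊗ V) := by
        have h := BraidedCategory.yang_baxter' H V A
        calc _ = Δ[H] ▷ (V ⊗ A) ≫ (H ⊗ H) ◁ V ◁ Δ[A] ⊗≫
              H ◁ (𝟙 ((H ⊗ V) ⊗ A) ⊗≫ (H ◁ (β_ V A).hom ⊗≫ (β_ H A).hom ▷ V ⊗≫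
              A ◁ (β_ H V).hom) ⊗≫ 𝟙 ((A ⊗ V) ⊗ H)) ▷ A ⊗≫
              (H ⊗ A ⊗ V) ◁ σ ⊗≫ 𝟙 ((H ⊗ A) ⊗ V) := by monoidal
          _ = _ := by
            rw [← h]
            monoidal
    _ = _ := by
        rw [← whisker_exchange, rightHit_outerForm, swapRight]
        monoidal

/-- The mirror image of `swapRight_rightHit`. -/
lemma swapLeft_leftHit {σ : H ⊗ A ⟶ 𝟙_ C} (hσ : SlidesAlong σ V) :
    swapLeft H V A ≫ V ◁ leftHit σ = leftHit (outerForm V σ) ≫ swapLeft H V A := by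
  calc _ = 𝟙 _ ⊗≫ ((β_ H V).hom ≫ V ◁ Δ[H]) ▷ A ⊗≫ (V ⊗ H ⊗ H) ◁ Δ[A] ⊗≫
        (V ⊗ H) ◁ (β_ H A).hom ▷ A ⊗≫ V ◁ σ ▷ (H ⊗ A) ⊗≫ 𝟙 (V ⊗ H ⊗ A) := by
        rw [leftHit_tensor, swapLeft]
        monoidal
    _ = Δ[H] ▷ (V ⊗ A) ⊗≫ (((H ◁ (β_ H V).hom) ⊗≫ (β_ H V).hom ▷ H ⊗≫ 𝟙 (V ⊗ H ⊗ H)) ▷ A ≫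
        (V ⊗ H ⊗ H) ◁ Δ[A]) ⊗≫
        (V ⊗ H) ◁ (β_ H A).hom ▷ A ⊗≫ V ◁ σ ▷ (H ⊗ A) ⊗≫ 𝟙 (V ⊗ H ⊗ A) := by
        rw [braiding_whiskerLeft_comul]
        monoidal
    _ = Δ[H] ▷ (V ⊗ A) ≫ (H ⊗ H) ◁ V ◁ Δ[A] ⊗≫ H ◁ (β_ H V).hom ▷ (A ⊗ A) ⊗≫
        (((β_ H V).hom ▷ (H ⊗ A) ≫ (V ⊗ H) ◁ (β_ H A).hom) ▷ A) ⊗≫ V ◁ σ ▷ (H ⊗ A) ⊗≫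
        𝟙 (V ⊗ H ⊗ A) := by
        rw [← whisker_exchange]
        monoidal
    _ = Δ[H] ▷ (V ⊗ A) ≫ (H ⊗ H) ◁ V ◁ Δ[A] ⊗≫ H ◁ (β_ H V).hom ▷ (A ⊗ A) ⊗≫
        (H ⊗ V) ◁ (β_ H A).hom ▷ A ⊗≫
        (𝟙 (H ⊗ V ⊗ A) ⊗≫ (β_ H V).hom ▷ A ⊗≫ V ◁ σ ⊗≫ 𝟙 V) ▷ (H ⊗ A) ⊗≫
        𝟙 (V ⊗ H ⊗ A) := by
        rw [← whisker_exchange]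
        monoidal
    _ = Δ[H] ▷ (V ⊗ A) ≫ (H ⊗ H) ◁ V ◁ Δ[A] ⊗≫
        H ◁ ((β_ H V).hom ▷ A ⊗≫ V ◁ (β_ H A).hom ⊗≫ (β_ V A).hom ▷ H) ▷ A ⊗≫
        σ ▷ (V ⊗ H ⊗ A) ⊗≫ 𝟙 (V ⊗ H ⊗ A) := by
        rw [← hσ.whiskerLeft_braiding]
        monoidal
    _ = Δ[H] ▷ (V ⊗ A) ≫ (H ⊗ H) ◁ V ◁ Δ[A] ⊗≫ (H ⊗ H) ◁ (β_ V A).hom ▷ A ⊗≫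
        H ◁ (β_ H A).hom ▷ (V ⊗ A) ⊗≫
        ((H ⊗ A) ◁ ((β_ H V).hom ▷ A) ≫ σ ▷ ((V ⊗ H) ⊗ A)) ⊗≫ 𝟙 (V ⊗ H ⊗ A) := by
        rw [BraidedCategory.yang_baxter' H V A]
        monoidal
    _ = _ := by
        rw [whisker_exchange, leftHit_outerForm, swapLeft]
        monoidal

variable {σ σ' : H ⊗ A ⟶ 𝟙_ C}

lemma IsInvForm.comp_outer (h : IsInvForm σ σ') :
    IsInvForm (outerForm V σ) (outerForm V σ') :=
  h.comp (H ◁ counitFst V A)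

lemma IsInvForm.swapRight_conjHit (h : IsInvForm σ σ') (hσ : SlidesAlong σ V) :
    swapRight H V A ≫ conjHit σ σ' ▷ V =
      conjHit (outerForm V σ) (outerForm V σ') ≫ swapRight H V A := by
  -- The relation for `σ'` follows from that for `σ`, so `σ'` need not be known to slide along `V`.
  have key : swapRight H V A ≫ rightHit σ' ▷ V =
      rightHit (outerForm V σ') ≫ swapRight H V A := by
    have e : rightHit σ ▷ V ≫ rightHit σ' ▷ V = 𝟙 _ := by
      rw [← comp_whiskerRight, h.rightHit_rightHit, id_whiskerRight]
    calc _ = rightHit (outerForm V σ') ≫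
          (rightHit (outerForm V σ) ≫ swapRight H V A) ≫ rightHit σ' ▷ V := by
          rw [Category.assoc, reassoc_of% h.comp_outer.symm.rightHit_rightHit]
      _ = _ := by rw [← swapRight_rightHit hσ, Category.assoc, e, Category.comp_id]
  simp only [conjHit, comp_whiskerRight, Category.assoc]
  rw [← key, ← reassoc_of% swapRight_leftHit]

lemma swapLeft_conjHit (hσ : SlidesAlong σ V) :
    swapLeft H V A ≫ V ◁ conjHit σ σ' =
      conjHit (outerForm V σ) (outerForm V σ') ≫ swapLeft H V A := by
  have key : rightHit (outerForm V σ') ≫ swapLeft H V A =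
      swapLeft H V A ≫ V ◁ rightHit σ' := (swapLeft_rightHit σ').symm
  simp only [conjHit, MonoidalCategory.whiskerLeft_comp, Category.assoc]
  rw [key, ← Category.assoc, swapLeft_leftHit hσ, Category.assoc]

end OuterLegs

/-! ### Products along a distributive exchange morphism -/

section SmashMul

variable {C : Type u} [Category.{v} C] [MonoidalCategory C]
variable {A H : C} [MonObj A] [MonObj H]

/-- The multiplication `(a ⊗ h) (b ⊗ g) = a ψ(h ⊗ b) g` on `A ⊗ H` given by an exchange
morphism `ψ : H ⊗ A ⟶ A ⊗ H`. -/
def smashMul (ψ : H ⊗ A ⟶ A ⊗ H) : (A ⊗ H) ⊗ (A ⊗ H) ⟶ A ⊗ H :=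
  𝟙 ((A ⊗ H) ⊗ (A ⊗ H)) ⊗≫ A ◁ ψ ▷ H ⊗≫ (μ[A] ⊗ₘ μ[H])

variable (A H) in
/-- `ψ` is a distributive law between the monoids `A` and `H`, i.e. it is compatible with the
multiplications and the units of both. -/
structure IsDistributive (ψ : H ⊗ A ⟶ A ⊗ H) : Prop where
  mul_left : μ[H] ▷ A ≫ ψ =
    (α_ H H A).hom ≫ H ◁ ψ ≫ (α_ H A H).inv ≫ ψ ▷ H ≫ (α_ A H H).hom ≫ A ◁ μ[H]
  mul_right : H ◁ μ[A] ≫ ψ =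
    (α_ H A A).inv ≫ ψ ▷ A ≫ (α_ A H A).hom ≫ A ◁ ψ ≫ (α_ A A H).inv ≫ μ[A] ▷ H
  one_left : η[H] ▷ A ≫ ψ = (λ_ A).hom ≫ (ρ_ A).inv ≫ A ◁ η[H]
  one_right : H ◁ η[A] ≫ ψ = (ρ_ H).hom ≫ (λ_ H).inv ≫ η[A] ▷ H

lemma smashMul_eq (ψ : H ⊗ A ⟶ A ⊗ H) :
    smashMul ψ = 𝟙 ((A ⊗ H) ⊗ (A ⊗ H)) ⊗≫ A ◁ ψ ▷ H ⊗≫ μ[A] ▷ (H ⊗ H) ⊗≫ A ◁ μ[H] := by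
  rw [smashMul, MonoidalCategory.tensorHom_def]
  monoidal

lemma smashMul_assoc {ψ : H ⊗ A ⟶ A ⊗ H} (h : IsDistributive A H ψ) :
    smashMul ψ ▷ (A ⊗ H) ≫ smashMul ψ =
      (α_ (A ⊗ H) (A ⊗ H) (A ⊗ H)).hom ≫ (A ⊗ H) ◁ smashMul ψ ≫ smashMul ψ := by
  calc _ = 𝟙 (((A ⊗ H) ⊗ A ⊗ H) ⊗ A ⊗ H) ⊗≫ A ◁ ψ ▷ (H ⊗ A ⊗ H) ⊗≫ μ[A] ▷ (H ⊗ H ⊗ A ⊗ H) ⊗≫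
        A ◁ (μ[H] ▷ A ≫ ψ) ▷ H ⊗≫ μ[A] ▷ (H ⊗ H) ⊗≫ A ◁ μ[H] := by
        rw [smashMul_eq]
        monoidal
    _ = 𝟙 (((A ⊗ H) ⊗ A ⊗ H) ⊗ A ⊗ H) ⊗≫ A ◁ ψ ▷ (H ⊗ A ⊗ H) ⊗≫
        (μ[A] ▷ (H ⊗ H ⊗ A ⊗ H) ≫ A ◁ (𝟙 (H ⊗ H ⊗ A ⊗ H) ⊗≫ (H ◁ ψ ⊗≫ ψ ▷ H) ▷ H)) ⊗≫
        ((A ⊗ A) ◁ μ[H] ▷ H ≫ μ[A] ▷ (H ⊗ H)) ⊗≫ A ◁ μ[H] := by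
        rw [h.mul_left]
        monoidal
    _ = 𝟙 (((A ⊗ H) ⊗ A ⊗ H) ⊗ A ⊗ H) ⊗≫ A ◁ (ψ ▷ ((H ⊗ A) ⊗ H) ≫ (A ⊗ H) ◁ ψ ▷ H) ⊗≫
        (A ⊗ A) ◁ ψ ▷ (H ⊗ H) ⊗≫ (μ[A] ▷ A ≫ μ[A]) ▷ (H ⊗ H ⊗ H) ⊗≫
        A ◁ (μ[H] ▷ H ≫ μ[H]) := by
        rw [whisker_exchange μ[A] (μ[H] ▷ H), ← whisker_exchange]
        monoidal
    _ = 𝟙 (((A ⊗ H) ⊗ A ⊗ H) ⊗ A ⊗ H) ⊗≫ (A ⊗ H ⊗ A) ◁ ψ ▷ H ⊗≫ A ◁ ψ ▷ (A ⊗ H ⊗ H) ⊗≫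
        (A ⊗ A) ◁ ψ ▷ (H ⊗ H) ⊗≫ (A ◁ μ[A] ≫ μ[A]) ▷ (H ⊗ H ⊗ H) ⊗≫
        A ◁ (H ◁ μ[H] ≫ μ[H]) := by
        rw [← whisker_exchange, MonObj.mul_assoc, MonObj.mul_assoc]
        monoidal
    _ = 𝟙 (((A ⊗ H) ⊗ A ⊗ H) ⊗ A ⊗ H) ⊗≫ (A ⊗ H ⊗ A) ◁ ψ ▷ H ⊗≫ A ◁ (H ◁ μ[A] ≫ ψ) ▷ (H ⊗ H) ⊗≫
        (μ[A] ▷ (H ⊗ H ⊗ H) ≫ A ◁ H ◁ μ[H]) ⊗≫ A ◁ μ[H] := by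
        rw [h.mul_right]
        monoidal
    _ = 𝟙 (((A ⊗ H) ⊗ A ⊗ H) ⊗ A ⊗ H) ⊗≫ (A ⊗ H ⊗ A) ◁ ψ ▷ H ⊗≫ (A ⊗ H) ◁ μ[A] ▷ (H ⊗ H) ⊗≫
        A ◁ (ψ ▷ (H ⊗ H) ≫ (A ⊗ H) ◁ μ[H]) ⊗≫ μ[A] ▷ (H ⊗ H) ⊗≫ A ◁ μ[H] := by
        rw [← whisker_exchange]
        monoidal
    _ = _ := by
        rw [← whisker_exchange, smashMul_eq]
        monoidal

lemma one_smashMul {ψ : H ⊗ A ⟶ A ⊗ H} (h : IsDistributive A H ψ) :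
    ((λ_ (𝟙_ C)).inv ≫ (η[A] ⊗ₘ η[H])) ▷ (A ⊗ H) ≫ smashMul ψ = (λ_ (A ⊗ H)).hom := by
  calc _ = 𝟙 (𝟙_ C ⊗ A ⊗ H) ⊗≫ η[A] ▷ (A ⊗ H) ⊗≫ A ◁ (η[H] ▷ A ≫ ψ) ▷ H ⊗≫ μ[A] ▷ (H ⊗ H) ⊗≫
        A ◁ μ[H] := by
        rw [smashMul_eq, MonoidalCategory.tensorHom_def]
        monoidal
    _ = 𝟙 (𝟙_ C ⊗ A ⊗ H) ⊗≫ η[A] ▷ (A ⊗ H) ⊗≫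
        ((A ⊗ A) ◁ η[H] ▷ H ≫ μ[A] ▷ (H ⊗ H)) ⊗≫ A ◁ μ[H] := by
        rw [h.one_left]
        monoidal
    _ = 𝟙 (𝟙_ C ⊗ A ⊗ H) ⊗≫ (η[A] ▷ A ≫ μ[A]) ▷ H ⊗≫ A ◁ (η[H] ▷ H ≫ μ[H]) := by
        rw [whisker_exchange]
        monoidal
    _ = _ := by
        rw [MonObj.one_mul, MonObj.one_mul]
        monoidal

lemma smashMul_one {ψ : H ⊗ A ⟶ A ⊗ H} (h : IsDistributive A H ψ) :
    (A ⊗ H) ◁ ((λ_ (𝟙_ C)).inv ≫ (η[A] ⊗ₘ η[H])) ≫ smashMul ψ = (ρ_ (A ⊗ H)).hom := by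
  calc _ = 𝟙 ((A ⊗ H) ⊗ 𝟙_ C) ⊗≫ (A ⊗ H) ◁ η[A] ⊗≫ A ◁ ((H ⊗ A) ◁ η[H] ≫ ψ ▷ H) ⊗≫ μ[A] ▷ (H ⊗ H) ⊗≫
        A ◁ μ[H] := by
        rw [smashMul_eq, MonoidalCategory.tensorHom_def]
        monoidal
    _ = 𝟙 ((A ⊗ H) ⊗ 𝟙_ C) ⊗≫ A ◁ (H ◁ η[A] ≫ ψ) ⊗≫ ((A ⊗ A) ◁ H ◁ η[H] ≫ μ[A] ▷ (H ⊗ H)) ⊗≫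
        A ◁ μ[H] := by
        rw [whisker_exchange]
        monoidal
    _ = 𝟙 ((A ⊗ H) ⊗ 𝟙_ C) ⊗≫ (A ◁ η[A] ≫ μ[A]) ▷ H ⊗≫ A ◁ (H ◁ η[H] ≫ μ[H]) := by
        rw [whisker_exchange, h.one_right]
        monoidal
    _ = _ := by
        rw [MonObj.mul_one, MonObj.mul_one]
        monoidal

/-- `ψ(h ⊗ a) · (b ⊗ g)` depends on `a b` only. -/
lemma whiskerRight_smashMul {ψ : H ⊗ A ⟶ A ⊗ H} (h : IsDistributive A H ψ) :
    ψ ▷ (A ⊗ H) ≫ smashMul ψ =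
      𝟙 ((H ⊗ A) ⊗ (A ⊗ H)) ⊗≫ (H ◁ μ[A] ≫ ψ) ▷ H ⊗≫ A ◁ μ[H] := by
  rw [h.mul_right, smashMul_eq]
  calc _ = 𝟙 ((H ⊗ A) ⊗ (A ⊗ H)) ⊗≫ ψ ▷ A ▷ H ⊗≫ A ◁ ψ ▷ H ⊗≫ μ[A] ▷ (H ⊗ H) ⊗≫ A ◁ μ[H] := by
        monoidal
    _ = _ := by monoidal

/-- `(a ⊗ h) · ψ(g ⊗ b)` depends on `h g` only. -/
lemma whiskerLeft_smashMul {ψ : H ⊗ A ⟶ A ⊗ H} (h : IsDistributive A H ψ) :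
    (A ⊗ H) ◁ ψ ≫ smashMul ψ =
      𝟙 ((A ⊗ H) ⊗ (H ⊗ A)) ⊗≫ A ◁ (μ[H] ▷ A ≫ ψ) ⊗≫ μ[A] ▷ H := by
  rw [h.mul_left, smashMul_eq]
  calc _ = 𝟙 ((A ⊗ H) ⊗ (H ⊗ A)) ⊗≫ A ◁ H ◁ ψ ⊗≫ A ◁ ψ ▷ H ⊗≫
        (μ[A] ▷ (H ⊗ H) ≫ A ◁ μ[H]) := by
        monoidal
    _ = _ := by
        rw [← whisker_exchange]
        monoidal

end SmashMul

/-! ### The braiding twisted by a skew pairing -/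

section TwistedSwap

variable {C : Type u} [Category.{v} C] [MonoidalCategory C] [BraidedCategory C]

instance isComonHom_mul (M : C) [BimonObj M] : IsComonHom μ[M] where
  hom_counit := BimonObj.mul_counit M
  hom_comul := by simp

/-- The twisted braiding `h ⊗ a ↦ τ(h₁, a₁) a₂ ⊗ h₂ τbar(h₃, a₃)`. -/
def twistedSwap {H A : C} [ComonObj H] [ComonObj A] (τ τbar : H ⊗ A ⟶ 𝟙_ C) : H ⊗ A ⟶ A ⊗ H :=
  conjHit τ τbar ≫ (β_ H A).hom

variable {A H : C} [BimonObj A] [BimonObj H] {τ τbar : H ⊗ A ⟶ 𝟙_ C}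

/-- The first multiplicativity of a skew pairing says that `τ(h h', a)` is the convolution product
on `H ⊗ H ⊗ A` of the forms `ε(h) τ(h', a)` and `τ(h, a) ε(h')`. -/
lemma IsSkewPairing.mul_left_eq (hτ : IsSkewPairing τ) :
    (α_ H H A).inv ≫ μ[H] ▷ A ≫ τ = leftHit (counitFst H (H ⊗ A) ≫ τ) ≫ outerForm H τ := by
  have h := hτ.mul_left
  simp only [id_tensorHom, tensorHom_id] at h
  have e : leftHit τ ≫ counitFst H A = H ◁ Δ[A] ⊗≫ τ ▷ A ⊗≫ 𝟙 A := by
    rw [leftHit, Category.assoc, Category.assoc, ← leftUnitor_naturality,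
      ← whisker_exchange_assoc, reassoc_of% comul_whiskerLeft_counitFst]
    monoidal
  rw [h, leftHit_counitFst, outerForm, ← MonoidalCategory.whiskerLeft_comp_assoc, e]
  monoidal

/-- The second multiplicativity of a skew pairing says that `τ(h, a a')` is the convolution product
on `H ⊗ A ⊗ A` of the forms `τ(h, a) ε(a')` and `τ(h, a') ε(a)`. -/
lemma IsSkewPairing.mul_right_eq (hτ : IsSkewPairing τ) :
    H ◁ μ[A] ≫ τ =
      leftHit ((α_ H A A).inv ≫ counitSnd (H ⊗ A) A ≫ τ) ≫ outerForm A τ := by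
  have h := hτ.mul_right
  simp only [id_tensorHom, tensorHom_id] at h
  have e : leftHit τ ≫ counitSnd H A = Δ[H] ▷ A ⊗≫ H ◁ (β_ H A).hom ⊗≫ τ ▷ H ⊗≫ 𝟙 H := by
    rw [leftHit, Category.assoc, Category.assoc, ← leftUnitor_naturality,
      ← whisker_exchange_assoc, reassoc_of% comul_whiskerLeft_counitSnd]
    monoidal
  have e' : (α_ H A A).hom ≫ H ◁ counitFst A A = counitSnd H A ▷ A := by
    simp only [counitFst, counitSnd]
    monoidal
  rw [h, ← cancel_epi (α_ H A A).hom, reassoc_of% comp_leftHit, Iso.hom_inv_id_assoc,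
    leftHit_counitSnd, outerForm, reassoc_of% e', ← comp_whiskerRight_assoc, e,
    MonoidalCategory.tensorHom_def τ τ,
    id_whiskerRight, MonoidalCategory.tensorHom_id]
  calc _ = Δ[H] ▷ A ▷ A ⊗≫ H ◁ (β_ H A).hom ▷ A ⊗≫ (τ ▷ (H ⊗ A) ≫ 𝟙_ C ◁ τ) ⊗≫ 𝟙 (𝟙_ C) := by
        monoidal
    _ = _ := by monoidal

attribute [local instance] ComonObj.instTensorUnit in
lemma isComonHom_leftUnitor_inv (Y : C) [ComonObj Y] : IsComonHom (λ_ Y).inv := by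
  have : IsComonHom (λ_ Y).hom := by
    have h : counitFst (𝟙_ C) Y = (λ_ Y).hom := by
      simp [counitFst, ComonObj.instTensorUnit_counit]
    exact h ▸ isComonHom_counitFst (𝟙_ C) Y
  infer_instance

attribute [local instance] ComonObj.instTensorUnit in
lemma isComonHom_rightUnitor_inv (Y : C) [ComonObj Y] : IsComonHom (ρ_ Y).inv := by
  have : IsComonHom (ρ_ Y).hom := by
    have h : counitSnd Y (𝟙_ C) = (ρ_ Y).hom := by
      simp [counitSnd, ComonObj.instTensorUnit_counit]
    exact h ▸ isComonHom_counitSnd Y (𝟙_ C)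
  infer_instance

attribute [local instance] ComonObj.instTensorUnit in
lemma isComonHom_one (M : C) [BimonObj M] : IsComonHom η[M] where
  hom_counit := BimonObj.one_counit M
  hom_comul := Bimon.one_comul M

attribute [local instance] ComonObj.instTensorUnit in
instance isComonHom_one_whiskerRight (M Y : C) [BimonObj M] [ComonObj Y] :
    IsComonHom ((λ_ Y).inv ≫ η[M] ▷ Y) := by
  have := isComonHom_one M
  have := isComonHom_leftUnitor_inv Y
  infer_instance

attribute [local instance] ComonObj.instTensorUnit in
instance isComonHom_whiskerLeft_one (Y M : C) [BimonObj M] [ComonObj Y] :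
    IsComonHom ((ρ_ Y).inv ≫ Y ◁ η[M]) := by
  have := isComonHom_one M
  have := isComonHom_rightUnitor_inv Y
  infer_instance

/-- The braiding is a distributive law by naturality. Conjugation by `τ` turns the products in
`IsSkewPairing.mul_left_eq` and `IsSkewPairing.mul_right_eq` into composites, whose factor on the
outer legs moves past the braiding by the symmetry of `τ`. -/
lemma IsSkewPairing.isDistributive_twistedSwap (hτ : IsSkewPairing τ) (h : IsInvForm τ τbar)
    (hs : IsBraidSymmetric τ) : IsDistributive A H (twistedSwap τ τbar) where
  mul_left := by
    let f : H ⊗ H ⊗ A ⟶ H ⊗ A := (α_ H H A).inv ≫ μ[H] ▷ A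
    have hf : f ≫ τ = leftHit (counitFst H (H ⊗ A) ≫ τ) ≫ outerForm H τ := by
      simpa [f] using hτ.mul_left_eq
    -- By uniqueness of convolution inverses, `τbar` is multiplicative in the reversed order.
    have hf' : f ≫ τbar = leftHit (outerForm H τbar) ≫ counitFst H (H ⊗ A) ≫ τbar :=
      (h.comp f).unique (hf ▸ (h.comp (counitFst H (H ⊗ A))).mul h.comp_outer)
    have hβ : f ≫ (β_ H A).hom =
        swapRight H H A ≫ (β_ H A).hom ▷ H ≫ (α_ A H H).hom ≫ A ◁ μ[H] := by
      simp only [f, swapRight, Category.assoc]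
      rw [BraidedCategory.braiding_naturality_left, BraidedCategory.braiding_tensor_left_hom]
      simp
    rw [← cancel_epi (α_ H H A).inv, Iso.inv_hom_id_assoc]
    calc _ = (f ≫ conjHit τ τbar) ≫ (β_ H A).hom := by simp [f, twistedSwap]
      _ = H ◁ conjHit τ τbar ≫ conjHit (outerForm H τ) (outerForm H τbar) ≫ f ≫
          (β_ H A).hom := by
          rw [comp_conjHit, hf, hf', conjHit_mul, conjHit_counitFst]
          simp only [Category.assoc]
      _ = _ := by
          rw [hβ, ← reassoc_of% h.swapRight_conjHit hs.left]
          simp [twistedSwap, swapRight]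
  mul_right := by
    let f : H ⊗ A ⊗ A ⟶ H ⊗ A := H ◁ μ[A]
    let g : H ⊗ A ⊗ A ⟶ H ⊗ A := (α_ H A A).inv ≫ counitSnd (H ⊗ A) A
    have hf : f ≫ τ = leftHit (g ≫ τ) ≫ outerForm A τ := by
      simpa [f, g] using hτ.mul_right_eq
    have hf' : f ≫ τbar = leftHit (outerForm A τbar) ≫ g ≫ τbar :=
      (h.comp f).unique (hf ▸ (h.comp g).mul h.comp_outer)
    have hg : conjHit (g ≫ τ) (g ≫ τbar) =
        (α_ H A A).inv ≫ conjHit τ τbar ▷ A ≫ (α_ H A A).hom := by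
      rw [← conjHit_counitSnd, reassoc_of% comp_conjHit]
      simp [g]
    have hβ : f ≫ (β_ H A).hom =
        swapLeft H A A ≫ A ◁ (β_ H A).hom ≫ (α_ A A H).inv ≫ μ[A] ▷ H := by
      simp only [f, swapLeft, Category.assoc]
      rw [BraidedCategory.braiding_naturality_right, BraidedCategory.braiding_tensor_right_hom]
      simp
    calc _ = (f ≫ conjHit τ τbar) ≫ (β_ H A).hom := by simp [f, twistedSwap]
      _ = ((α_ H A A).inv ≫ conjHit τ τbar ▷ A ≫ (α_ H A A).hom) ≫
          conjHit (outerForm A τ) (outerForm A τbar) ≫ f ≫ (β_ H A).hom := by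
          rw [comp_conjHit, hf, hf', conjHit_mul, hg]
          simp only [Category.assoc]
      _ = _ := by
          rw [hβ, ← reassoc_of% swapLeft_conjHit hs.right]
          simp [twistedSwap, swapLeft]
  one_left := by
    have h₁ : ((λ_ A).inv ≫ η[H] ▷ A) ≫ τ = ε[A] := by
      simpa [monoidalComp] using hτ.one_left
    have h₂ := comp_conjHit_of_comp_eq_counit h _ h₁
    rw [← cancel_epi (λ_ A).inv, twistedSwap, ← Category.assoc, ← Category.assoc, h₂,
      Category.assoc,
      BraidedCategory.braiding_naturality_left, braiding_tensorUnit_left]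
    simp
  one_right := by
    have h₁ : ((ρ_ H).inv ≫ H ◁ η[A]) ≫ τ = ε[H] := by
      simpa [monoidalComp] using hτ.one_right
    have h₂ := comp_conjHit_of_comp_eq_counit h _ h₁
    rw [← cancel_epi (ρ_ H).inv, twistedSwap, ← Category.assoc, ← Category.assoc, h₂,
      Category.assoc,
      BraidedCategory.braiding_naturality_right, braiding_tensorUnit_right]
    simp

lemma leftAct_eq : leftAct τ τbar = conjHit τ τbar ≫ counitFst H A := by
  have e : rightHit τbar ≫ counitFst H A =
      𝟙 (H ⊗ A) ⊗≫ (H ◁ Δ[A] ⊗≫ (β_ H A).hom ▷ A) ⊗≫ A ◁ τbar ⊗≫ 𝟙 A := by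
    rw [rightHit, Category.assoc, Category.assoc, ← rightUnitor_naturality,
      whisker_exchange_assoc, reassoc_of% comul_counitFst_whiskerRight]
    monoidal
  symm
  calc _ = Δ[H] ▷ A ≫ (H ⊗ H) ◁ Δ[A] ⊗≫ H ◁ (β_ H A).hom ▷ A ⊗≫
        (τ ▷ (H ⊗ A) ≫ 𝟙_ C ◁ (H ◁ Δ[A] ⊗≫ (β_ H A).hom ▷ A)) ⊗≫ A ◁ τbar ⊗≫ 𝟙 A := by
        rw [conjHit, Category.assoc, e, leftHit_tensor]
        monoidal
    _ = _ := by
        rw [← whisker_exchange, leftAct]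
        simp only [MonoidalCategory.tensorHom_def]
        monoidal

lemma rightAct_eq : rightAct τ τbar = conjHit τ τbar ≫ counitSnd H A := by
  have e : rightHit τbar ≫ counitSnd H A =
      𝟙 (H ⊗ A) ⊗≫ Δ[H] ▷ A ⊗≫ H ◁ τbar ⊗≫ 𝟙 H := by
    rw [rightHit, Category.assoc, Category.assoc, ← rightUnitor_naturality,
      whisker_exchange_assoc, reassoc_of% comul_counitSnd_whiskerRight]
    monoidal
  symm
  calc _ = Δ[H] ▷ A ≫ (H ⊗ H) ◁ Δ[A] ⊗≫ H ◁ (β_ H A).hom ▷ A ⊗≫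
        (τ ▷ (H ⊗ A) ≫ 𝟙_ C ◁ (Δ[H] ▷ A)) ⊗≫ H ◁ τbar ⊗≫ 𝟙 H := by
        rw [conjHit, Category.assoc, e, leftHit_tensor]
        monoidal
    _ = Δ[H] ▷ A ≫ (H ⊗ H) ◁ Δ[A] ⊗≫ H ◁ ((β_ H A).hom ≫ A ◁ Δ[H]) ▷ A ⊗≫
        τ ▷ (H ⊗ H ⊗ A) ⊗≫ H ◁ τbar ⊗≫ 𝟙 H := by
        rw [← whisker_exchange]
        monoidal
    _ = (Δ[H] ▷ A ≫ (H ⊗ H) ◁ Δ[A]) ⊗≫ H ◁ Δ[H] ▷ (A ⊗ A) ⊗≫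
        (H ⊗ H) ◁ (β_ H A).hom ▷ A ⊗≫ H ◁ (β_ H A).hom ▷ (H ⊗ A) ⊗≫
        τ ▷ (H ⊗ H ⊗ A) ⊗≫ H ◁ τbar ⊗≫ 𝟙 H := by
        rw [braiding_whiskerLeft_comul]
        monoidal
    _ = (H ◁ Δ[A] ≫ Δ[H] ▷ (A ⊗ A)) ⊗≫ Δ[H] ▷ (H ⊗ A ⊗ A) ⊗≫
        (H ⊗ H) ◁ (β_ H A).hom ▷ A ⊗≫ H ◁ (β_ H A).hom ▷ (H ⊗ A) ⊗≫
        τ ▷ (H ⊗ H ⊗ A) ⊗≫ H ◁ τbar ⊗≫ 𝟙 H := by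
        rw [← whisker_exchange]
        calc _ = H ◁ Δ[A] ≫ (Δ[H] ≫ H ◁ Δ[H]) ▷ (A ⊗ A) ⊗≫
              (H ⊗ H) ◁ (β_ H A).hom ▷ A ⊗≫ H ◁ (β_ H A).hom ▷ (H ⊗ A) ⊗≫
              τ ▷ (H ⊗ H ⊗ A) ⊗≫ H ◁ τbar ⊗≫ 𝟙 H := by monoidal
          _ = _ := by
            rw [ComonObj.comul_assoc]
            monoidal
    _ = _ := by
        rw [whisker_exchange, rightAct]
        simp only [MonoidalCategory.tensorHom_def]
        monoidal

/-- `(α ⊗ β) Δ` is the twisted braiding. -/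
lemma comul_leftAct_tensorHom_rightAct (h : IsInvForm τ τbar) :
    Δ[H ⊗ A] ≫ (leftAct τ τbar ⊗ₘ rightAct τ τbar) = twistedSwap τ τbar := by
  rw [leftAct_eq, rightAct_eq, h.comul_conjHit, comul_counitFst_tensorHom_counitSnd, twistedSwap]

lemma crossMul_eq_smashMul (h : IsInvForm τ τbar) :
    crossMul (leftAct τ τbar) (rightAct τ τbar) = smashMul (twistedSwap τ τbar) := by
  rw [← comul_leftAct_tensorHom_rightAct h, smashMul, crossMul, tensorObj_comul_eq]
  simp only [MonoidalCategory.tensorHom_def]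
  monoidal

end TwistedSwap

/-! ### The antipode -/

section Antipode

variable {C : Type u} [Category.{v} C] [MonoidalCategory C] [BraidedCategory C]
variable {A H : C} [BimonObj A] [BimonObj H] {ψ : H ⊗ A ⟶ A ⊗ H}

/-- If `A` and `H` have antipodes, then `a ⊗ h ↦ S(h) S(a)` is an antipode of the product of `A`
and `H` along a distributive law `ψ`: the braiding exchanges `a` and `h`, and `ψ` is the product
of an element of `H` and an element of `A`. Compatibility with the coalgebra structure is not
needed. -/
lemma isAntipode_smashMul (h : IsDistributive A H ψ) {SA : A ⟶ A} {SH : H ⟶ H}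
    (hA : IsAntipode μ[A] η[A] Δ[A] ε[A] SA) (hH : IsAntipode μ[H] η[H] Δ[H] ε[H] SH) :
    IsAntipode (smashMul ψ) (crossOne A H) (tensorComul A H) (tensorCounit A H)
      ((β_ A H).hom ≫ (SH ⊗ₘ SA) ≫ ψ) where
  left := by
    have hA' : Δ[A] ≫ SA ▷ A ≫ μ[A] = ε[A] ≫ η[A] := by simpa using hA.left
    have hH' : Δ[H] ≫ SH ▷ H ≫ μ[H] = ε[H] ≫ η[H] := by simpa using hH.left
    have e₁ : Δ[A] ▷ H ≫ (β_ (A ⊗ A) H).hom ≫ SH ▷ (A ⊗ A) ≫ H ◁ (SA ▷ A ≫ μ[A]) ≫ ψ =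
        ε[A] ▷ H ⊗≫ SH ⊗≫ η[A] ▷ H := by
      calc _ = (β_ A H).hom ≫ (H ◁ Δ[A] ≫ SH ▷ (A ⊗ A)) ≫ H ◁ (SA ▷ A ≫ μ[A]) ≫ ψ := by
            rw [BraidedCategory.braiding_naturality_left_assoc]; simp
        _ = (β_ A H).hom ≫ SH ▷ A ≫ H ◁ (Δ[A] ≫ SA ▷ A ≫ μ[A]) ≫ ψ := by
            rw [whisker_exchange]; simp
        _ = ((β_ A H).hom ≫ H ◁ ε[A]) ≫ SH ▷ 𝟙_ C ≫ H ◁ η[A] ≫ ψ := by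
            rw [hA', MonoidalCategory.whiskerLeft_comp_assoc, ← whisker_exchange_assoc]
            simp only [Category.assoc]
        _ = _ := by
            rw [← BraidedCategory.braiding_naturality_left, braiding_tensorUnit_left,
              h.one_right]
            monoidal
    calc _ = Δ[A] ▷ H ≫ (A ⊗ A) ◁ Δ[H] ⊗≫ A ◁ (β_ A H).hom ▷ H ⊗≫ (β_ A H).hom ▷ (A ⊗ H) ⊗≫
          SH ▷ (A ⊗ A ⊗ H) ⊗≫ H ◁ SA ▷ (A ⊗ H) ⊗≫ ψ ▷ (A ⊗ H) ≫ smashMul ψ := by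
          rw [tensorComul_eq_comul, tensorObj_comul_eq, MonoidalCategory.tensorHom_def SH]
          monoidal
      _ = (Δ[A] ▷ H ≫ (A ⊗ A) ◁ Δ[H]) ⊗≫ ((β_ (A ⊗ A) H).hom ≫ SH ▷ (A ⊗ A) ≫
          H ◁ (SA ▷ A ≫ μ[A]) ≫ ψ) ▷ H ⊗≫ A ◁ μ[H] := by
          rw [whiskerRight_smashMul h, BraidedCategory.braiding_tensor_left_hom]
          monoidal
      _ = A ◁ Δ[H] ⊗≫ (Δ[A] ▷ H ≫ (β_ (A ⊗ A) H).hom ≫ SH ▷ (A ⊗ A) ≫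
          H ◁ (SA ▷ A ≫ μ[A]) ≫ ψ) ▷ H ⊗≫ A ◁ μ[H] := by
          rw [← whisker_exchange]
          monoidal
      _ = (A ◁ Δ[H] ≫ ε[A] ▷ (H ⊗ H)) ⊗≫ SH ▷ H ⊗≫ (η[A] ▷ (H ⊗ H) ≫ A ◁ μ[H]) := by
          rw [e₁]
          monoidal
      _ = ε[A] ▷ H ⊗≫ (Δ[H] ≫ SH ▷ H ≫ μ[H]) ⊗≫ η[A] ▷ H := by
          rw [whisker_exchange ε[A] Δ[H], ← whisker_exchange η[A] μ[H]]
          monoidal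
      _ = ε[A] ▷ H ⊗≫ ε[H] ⊗≫ (𝟙_ C ◁ η[H] ≫ η[A] ▷ H) := by
          rw [hH']
          monoidal
      _ = _ := by
          rw [whisker_exchange, tensorCounit, crossOne, MonoidalCategory.tensorHom_def,
            MonoidalCategory.tensorHom_def]
          monoidal
  right := by
    have hA' : Δ[A] ≫ A ◁ SA ≫ μ[A] = ε[A] ≫ η[A] := by simpa using hA.right
    have hH' : Δ[H] ≫ H ◁ SH ≫ μ[H] = ε[H] ≫ η[H] := by simpa using hH.right
    have e₁ : A ◁ Δ[H] ≫ (β_ A (H ⊗ H)).hom ≫ (H ◁ SH ≫ μ[H]) ▷ A ≫ H ◁ SA ≫ ψ =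
        A ◁ ε[H] ⊗≫ SA ⊗≫ A ◁ η[H] := by
      calc _ = (β_ A H).hom ≫ (Δ[H] ≫ H ◁ SH ≫ μ[H]) ▷ A ≫ H ◁ SA ≫ ψ := by
            rw [BraidedCategory.braiding_naturality_right_assoc]; simp
        _ = ((β_ A H).hom ≫ ε[H] ▷ A) ≫ (η[H] ▷ A ≫ H ◁ SA) ≫ ψ := by
            rw [hH', comp_whiskerRight]
            simp only [Category.assoc]
        _ = _ := by
            rw [← whisker_exchange, Category.assoc, Category.assoc,
              ← BraidedCategory.braiding_naturality_right_assoc,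
              braiding_tensorUnit_right, h.one_left]
            monoidal
    calc _ = Δ[A] ▷ H ≫ (A ⊗ A) ◁ Δ[H] ⊗≫ A ◁ (β_ A H).hom ▷ H ⊗≫ (A ⊗ H) ◁ (β_ A H).hom ⊗≫
          A ◁ H ◁ SH ▷ A ⊗≫ A ◁ H ◁ H ◁ SA ⊗≫ (A ⊗ H) ◁ ψ ≫ smashMul ψ := by
          rw [tensorComul_eq_comul, tensorObj_comul_eq, MonoidalCategory.tensorHom_def SH]
          monoidal
      _ = Δ[A] ▷ H ⊗≫ A ◁ (A ◁ Δ[H] ≫ (β_ A (H ⊗ H)).hom ≫ (H ◁ SH) ▷ A ≫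
          ((H ⊗ H) ◁ SA ≫ μ[H] ▷ A) ≫ ψ) ⊗≫ μ[A] ▷ H := by
          rw [whiskerLeft_smashMul h, BraidedCategory.braiding_tensor_right_hom]
          monoidal
      _ = Δ[A] ▷ H ⊗≫ A ◁ (A ◁ Δ[H] ≫ (β_ A (H ⊗ H)).hom ≫ (H ◁ SH ≫ μ[H]) ▷ A ≫
          H ◁ SA ≫ ψ) ⊗≫ μ[A] ▷ H := by
          rw [whisker_exchange]
          monoidal
      _ = (Δ[A] ▷ H ≫ (A ⊗ A) ◁ ε[H]) ⊗≫ A ◁ SA ⊗≫ ((A ⊗ A) ◁ η[H] ≫ μ[A] ▷ H) := by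
          rw [e₁]
          monoidal
      _ = A ◁ ε[H] ⊗≫ (Δ[A] ≫ A ◁ SA ≫ μ[A]) ⊗≫ A ◁ η[H] := by
          rw [whisker_exchange, ← whisker_exchange]
          monoidal
      _ = (A ◁ ε[H] ≫ ε[A] ▷ 𝟙_ C) ⊗≫ η[A] ⊗≫ A ◁ η[H] := by
          rw [hA']
          monoidal
      _ = _ := by
          rw [whisker_exchange, tensorCounit, crossOne, MonoidalCategory.tensorHom_def,
            MonoidalCategory.tensorHom_def]
          monoidal

end Antipode

/-! ### Compatibility with the coalgebra structure -/

section Bialgebra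

variable {C : Type u} [Category.{v} C] [MonoidalCategory C] [BraidedCategory C]
variable {A H : C} [BimonObj A] [BimonObj H] {τ τbar : H ⊗ A ⟶ 𝟙_ C}

lemma isComonHom_smashMul (ψ : H ⊗ A ⟶ A ⊗ H) [IsComonHom ψ] : IsComonHom (smashMul ψ) := by
  have := isComonHom_tensorHom μ[A] μ[H]
  have h : smashMul ψ = (α_ A H (A ⊗ H)).hom ≫ A ◁ (α_ H A H).inv ≫ A ◁ ψ ▷ H ≫
      A ◁ (α_ A H H).hom ≫ (α_ A A (H ⊗ H)).inv ≫ (μ[A] ⊗ₘ μ[H]) := by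
    rw [smashMul]
    monoidal
  rw [h]
  infer_instance

/-- `ψ(h ⊗ a)` is the product `(1 ⊗ h) (a ⊗ 1)`. -/
lemma units_smashMul {ψ : H ⊗ A ⟶ A ⊗ H} :
    ((λ_ H).inv ≫ η[A] ▷ H ⊗ₘ (ρ_ A).inv ≫ A ◁ η[H]) ≫ smashMul ψ = ψ := by
  calc _ = 𝟙 (H ⊗ A) ⊗≫ η[A] ▷ (H ⊗ A) ⊗≫ A ◁ ((H ⊗ A) ◁ η[H] ≫ ψ ▷ H) ⊗≫
        μ[A] ▷ (H ⊗ H) ⊗≫ A ◁ μ[H] := by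
        rw [smashMul_eq, MonoidalCategory.tensorHom_def]
        monoidal
    _ = 𝟙 (H ⊗ A) ⊗≫ (η[A] ▷ (H ⊗ A) ≫ A ◁ ψ) ⊗≫ ((A ⊗ A) ◁ H ◁ η[H] ≫ μ[A] ▷ (H ⊗ H)) ⊗≫
        A ◁ μ[H] := by
        rw [whisker_exchange]
        monoidal
    _ = ψ ⊗≫ (η[A] ▷ A ≫ μ[A]) ▷ H ⊗≫ A ◁ (H ◁ η[H] ≫ μ[H]) := by
        rw [whisker_exchange, ← whisker_exchange]
        monoidal
    _ = _ := by
        rw [MonObj.one_mul, MonObj.mul_one]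
        monoidal

lemma isComonHom_of_smashMul (ψ : H ⊗ A ⟶ A ⊗ H) [IsComonHom (smashMul ψ)] : IsComonHom ψ := by
  have := isComonHom_tensorHom ((λ_ H).inv ≫ η[A] ▷ H) ((ρ_ A).inv ≫ A ◁ η[H])
  rw [← units_smashMul (ψ := ψ)]
  infer_instance

/-- Conjugation by an invertible form is a coalgebra automorphism, so that the twisted braiding is a
coalgebra morphism exactly if the braiding is. -/
lemma isComonHom_twistedSwap_iff (h : IsInvForm τ τbar) :
    IsComonHom (twistedSwap τ τbar) ↔ (β_ H A).hom ≫ (β_ A H).hom = 𝟙 (H ⊗ A) := by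
  refine ⟨fun hψ ↦ braiding_braiding_of_isComonHom ?_, fun hβ ↦ ?_⟩
  · have := h.symm.isComonHom_conjHit
    have e : conjHit τbar τ ≫ twistedSwap τ τbar = (β_ H A).hom :=
      (reassoc_of% h.symm.conjHit_conjHit) _
    rw [← e]
    infer_instance
  · have := h.isComonHom_conjHit
    have := isComonHom_braiding hβ
    rw [twistedSwap]
    infer_instance

lemma IsConvInverse.isInvForm (h : IsConvInverse τ τbar) : IsInvForm τ τbar where
  mul_inv := by
    rw [← tensorCounit_eq_counit, ← h.mul_inv, convMul, tensorComul_eq_comul, ← comul_tensorHom]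
    monoidal
  inv_mul := by
    rw [← tensorCounit_eq_counit, ← h.inv_mul, convMul, tensorComul_eq_comul, ← comul_tensorHom]
    monoidal

lemma crossOne_eq : crossOne A H = (λ_ (𝟙_ C)).inv ≫ (η[A] ⊗ₘ η[H]) := by
  rw [crossOne]
  monoidal

/-- The monoid `A ⊗ H` given by a distributive law. -/
@[reducible]
def smashMonObj {ψ : H ⊗ A ⟶ A ⊗ H} (h : IsDistributive A H ψ) : MonObj (A ⊗ H) where
  mul := smashMul ψ
  one := crossOne A H
  one_mul := by rw [crossOne_eq]; exact one_smashMul h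
  mul_one := by rw [crossOne_eq]; exact smashMul_one h
  mul_assoc := smashMul_assoc h

attribute [local instance] ComonObj.instTensorUnit in
lemma isComonHom_crossOne : IsComonHom (crossOne A H) := by
  have := isComonHom_one A
  have := isComonHom_one H
  have := isComonHom_tensorHom η[A] η[H]
  have := isComonHom_leftUnitor_inv (𝟙_ C)
  rw [crossOne_eq]
  infer_instance

/-- The bialgebra `A ⊗ H` given by a distributive law that is a coalgebra morphism. The
comultiplication is that of the tensor product coalgebra. -/
@[reducible]
def smashBimonObj {ψ : H ⊗ A ⟶ A ⊗ H} (h : IsDistributive A H ψ) [IsComonHom ψ] :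
    BimonObj (A ⊗ H) :=
  have hm : IsComonHom (smashMul ψ) := isComonHom_smashMul ψ
  { smashMonObj h, (inferInstance : ComonObj (A ⊗ H)) with
    mul_comul := by
      have := hm.hom_comul
      rw [Comon.tensorObj_comul (A ⊗ H), Category.assoc] at this
      exact this
    mul_counit := hm.hom_counit
    one_comul := (isComonHom_crossOne (A := A) (H := H)).hom_comul
    one_counit := (isComonHom_crossOne (A := A) (H := H)).hom_counit }

end Bialgebra

end DoubleCross

/-- The double cross product of bialgebras `A`, `H` along an invertible skew pairing `τ` that is
symmetric with respect to the braiding: it is an algebra and a coalgebra, it has an antipode if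
`A` and `H` have one, and it is a bialgebra iff `C_{A,H} C_{H,A} = id`. -/
theorem theorem3p1 {C : Type u} [Category.{v} C] [MonoidalCategory C] [BraidedCategory C]
    (A H : C) [BimonObj A] [BimonObj H] (τ τbar : H ⊗ A ⟶ 𝟙_ C)
    (hτ : DoubleCross.IsSkewPairing τ) (hinv : DoubleCross.IsConvInverse τ τbar)
    (hsymm : DoubleCross.IsBraidSymmetric τ) :
    (∃ alg : MonObj (A ⊗ H),
      alg.mul = DoubleCross.crossMul (DoubleCross.leftAct τ τbar) (DoubleCross.rightAct τ τbar) ∧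
      alg.one = DoubleCross.crossOne A H) ∧
    (∃ coalg : ComonObj (A ⊗ H),
      coalg.comul = DoubleCross.tensorComul A H ∧
      coalg.counit = DoubleCross.tensorCounit A H) ∧
    ((∃ SA : A ⟶ A, DoubleCross.IsAntipode μ[A] η[A] Δ[A] ε[A] SA) →
      (∃ SH : H ⟶ H, DoubleCross.IsAntipode μ[H] η[H] Δ[H] ε[H] SH) →
      ∃ S : A ⊗ H ⟶ A ⊗ H, DoubleCross.IsAntipode
        (DoubleCross.crossMul (DoubleCross.leftAct τ τbar) (DoubleCross.rightAct τ τbar))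
        (DoubleCross.crossOne A H) (DoubleCross.tensorComul A H) (DoubleCross.tensorCounit A H)
        S) ∧
    ((∃ bialg : BimonObj (A ⊗ H),
      bialg.mul = DoubleCross.crossMul (DoubleCross.leftAct τ τbar) (DoubleCross.rightAct τ τbar) ∧
      bialg.one = DoubleCross.crossOne A H ∧
      bialg.comul = DoubleCross.tensorComul A H ∧
      bialg.counit = DoubleCross.tensorCounit A H) ↔
      (β_ H A).hom ≫ (β_ A H).hom = 𝟙 (H ⊗ A)) := by
  have h := hinv.isInvForm
  have hψ := hτ.isDistributive_twistedSwap h hsymm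
  have hm := DoubleCross.crossMul_eq_smashMul h
  refine ⟨⟨DoubleCross.smashMonObj hψ, hm.symm, rfl⟩,
    ⟨inferInstance, DoubleCross.tensorComul_eq_comul.symm, DoubleCross.tensorCounit_eq_counit.symm⟩,
    ?_, ?_⟩
  · rintro ⟨SA, hA⟩ ⟨SH, hH⟩
    rw [hm]
    exact ⟨_, DoubleCross.isAntipode_smashMul hψ hA hH⟩
  · rw [← DoubleCross.isComonHom_twistedSwap_iff h]
    constructor
    · rintro ⟨bialg, h₁, -, h₃, h₄⟩
      rw [hm] at h₁
      rw [DoubleCross.tensorComul_eq_comul] at h₃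
      rw [DoubleCross.tensorCounit_eq_counit] at h₄
      have : IsComonHom (DoubleCross.smashMul (DoubleCross.twistedSwap τ τbar)) := by
        have e₁ := bialg.mul_comul
        have e₂ := bialg.mul_counit
        constructor
        · rw [← h₁, ← h₄]
          exact e₂.trans (by rw [Comon.tensorObj_counit, Comon.tensorObj_counit (A ⊗ H), h₄])
        · rw [← h₁, ← h₃]
          exact e₁.trans (by rw [Comon.tensorObj_comul (A ⊗ H), h₃, Category.assoc])
      exact DoubleCross.isComonHom_of_smashMul _
    · intro hc
      exact ⟨DoubleCross.smashBimonObj hψ, hm.symm, rfl,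
        DoubleCross.tensorComul_eq_comul.symm, DoubleCross.tensorCounit_eq_counit.symm⟩
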